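/- Let $b\in\mathbb{R}$, $b\neq 0$, and let $\mathbf{L}_2^{\mathbf A} = -\partial_{x_1x_1}^2 + (-\mathrm{i}\partial_{x_2} + b x_1)^2$ be the Landau operator in $L^2(\mathbb{R}^2;\mathbb{C})$, with maximal domain (all $f\in L^2(\mathbb{R}^2)$ for which $\mathbf{L}_2^{\mathbf A} f$, computed in the sense of tempered distributions, belongs to $L^2(\mathbb{R}^2)$). For $n\in\mathbb{N}_0=\{0,1,2,\dots\}$ let $$\varphi_n(x) = \frac{(2^n n!)^{-1/2}}{\pi^{1/4}}\,|b|^{1/4}\,\mathcal{H}_n\big(\sqrt{|b|}\,x\big)\,\mathrm{e}^{-\frac12|b|x^2},\qquad \mathcal{H}_n(x) = (-1)^n\mathrm{e}^{x^2}\frac{\mathrm{d}^n}{\mathrm{d}x^n}\mathrm{e}^{-x^2},$$ and for $\varphi,g\in L^2(\mathbb{R};\mathbb{C})$ and $\mathbf{x}=(x_1,x_2)\in\mathbb{R}^2$ let $$\mathcal{W}(\varphi,g)(\mathbf{x}) = \frac1{\sqrt{2\pi}}\int_{\mathbb{R}}\mathrm{e}^{-\mathrm{i}kx_2}\,\varphi\Big(x_1-\frac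 kb\Big)\,g(k)\,\mathrm{d}k .$$ Then: 1. $\mathbf{L}_2^{\mathbf A}$ is self-adjoint, it has pure point spectrum (its eigenvectors span a dense subspace of $L^2(\mathbb{R}^2)$), and $\sigma(\mathbf{L}_2^{\mathbf A}) = \{\varepsilon_n : n\in\mathbb{N}_0\}$, where $\varepsilon_n = |b|(2n+1)$. 2. For all $\varphi,g\in L^2(\mathbb{R})$ the integral defining $\mathcal{W}(\varphi,g)(\mathbf{x})$ converges absolutely for every $\mathbf{x}\in\mathbb{R}^2$, and $\mathcal{W}(\varphi,g)\in L^2(\mathbb{R}^2)$. 3. For every $n\in\mathbb{N}_0$, $\varepsilon_n$ is an eigenvalue of infinite multiplicity, $\varphi_n\in L^2(\mathbb{R})$, and the eigenspace is $$E_n := \ker(\mathbf{L}_2^{\mathbf A}-\varepsilon_n) = \{\mathcal{W}(\varphi_n,g) : g\in L^2(\mathbb{R})\}.$$ 4. For every $n\in\mathbb{N}_0$, the orthogonal projector $\mathbf{P}_n$ onto $E_n$ is the integral operator with kernel $$\mathbf{P}_n(\mathbf{x};\mathbf{y}) = \frac1{2\pi}\int_{\mathbb{R}}\mathrm{e}^{-\mathrm{i}k(x_2-y_2)}\,\varphi_n\Big(x_1-\frac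 kb\Big)\,\varphi_n\Big(y_1-\frac kb\Big)\,\mathrm{d}k$$ (an absolutely convergent integral for all $\mathbf{x},\mathbf{y}\in\mathbb{R}^2$): for every $f\in L^2(\mathbb{R}^2)$, the function $\mathbf{y}\mapsto\mathbf{P}_n(\mathbf{x};\mathbf{y})f(\mathbf{y})$ is integrable for every $\mathbf{x}\in\mathbb{R}^2$, and $(\mathbf{P}_nf)(\mathbf{x}) = \int_{\mathbb{R}^2}\mathbf{P}_n(\mathbf{x};\mathbf{y})f(\mathbf{y})\,\mathrm{d}\mathbf{y}$ for almost every $\mathbf{x}$. Its density $\mathbf{P}_n(\mathbf{x};\mathbf{x}) = \dfrac{|b|}{2\pi}$ is constant and independent of $n$. -/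

import Mathlib

open MeasureTheory SchwartzMap LineDeriv
open scoped ENNReal InnerProductSpace

noncomputable section

/-- The Hilbert space `L²(ℝ; ℂ)`. -/
abbrev L2Line : Type := Lp ℂ 2 (volume : Measure ℝ)

/-- The Hilbert space `L²(ℝ²; ℂ)`. -/
abbrev L2Plane : Type := Lp ℂ 2 (volume : Measure (ℝ × ℝ))

/-! ### Spectral notions for unbounded operators -/

/-- The kernel of `T - z`: the vectors `f` in the domain of `T` with `T f = z f`. -/
def pmapEigenspace {H : Type*} [NormedAddCommGroup H] [InnerProductSpace ℂ H]
    (T : H →ₗ.[ℂ] H) (z : ℂ) : Submodule ℂ H where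
  carrier := {f | ∃ hf : f ∈ T.domain, T ⟨f, hf⟩ = z • f}
  zero_mem' := ⟨T.domain.zero_mem, by
    rw [smul_zero]; exact LinearPMap.map_zero T⟩
  add_mem' := by
    rintro f g ⟨hf, ef⟩ ⟨hg, eg⟩
    refine ⟨T.domain.add_mem hf hg, ?_⟩
    rw [smul_add, ← ef, ← eg]
    exact T.map_add ⟨f, hf⟩ ⟨g, hg⟩
  smul_mem' := by
    rintro c f ⟨hf, ef⟩
    refine ⟨T.domain.smul_mem c hf, ?_⟩
    rw [smul_comm, ← ef]
    exact T.map_smul c ⟨f, hf⟩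

/-- The spectrum of an unbounded operator: the complex numbers `z` for which `T - z`, from the
domain of `T` onto the whole space, has no everywhere defined bounded two-sided inverse. -/
def pmapSpectrum {H : Type*} [NormedAddCommGroup H] [InnerProductSpace ℂ H]
    (T : H →ₗ.[ℂ] H) : Set ℂ :=
  {z | ¬ ∃ R : H →L[ℂ] H,
    (∀ y : H, ∃ hy : R y ∈ T.domain, T ⟨R y, hy⟩ - z • R y = y) ∧
    (∀ x : T.domain, R (T x - z • (x : H)) = x)}

/-- Pure point spectrum: the eigenvectors span a dense subspace. -/
def HasPurePointSpectrum {H : Type*} [NormedAddCommGroup H] [InnerProductSpace ℂ H]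
    (T : H →ₗ.[ℂ] H) : Prop :=
  (⨆ z : ℂ, pmapEigenspace T z).topologicalClosure = ⊤

/-! ### The Landau operator -/

/-- `u ↦ -i ∂₂ u + b x₁ u` on Schwartz functions. -/
def momentumTwo (b : ℝ) : 𝓢(ℝ × ℝ, ℂ) →L[ℂ] 𝓢(ℝ × ℝ, ℂ) :=
  (-Complex.I) • lineDerivOpCLM ℂ 𝓢(ℝ × ℝ, ℂ) ((0, 1) : ℝ × ℝ)
    + smulLeftCLM ℂ (fun x : ℝ × ℝ => ((b * x.1 : ℝ) : ℂ))

/-- The differential expression `-∂₁² + (-i ∂₂ + b x₁)²` on Schwartz functions. -/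
def landauSchwartz (b : ℝ) : 𝓢(ℝ × ℝ, ℂ) →L[ℂ] 𝓢(ℝ × ℝ, ℂ) :=
  -(lineDerivOpCLM ℂ 𝓢(ℝ × ℝ, ℂ) ((1, 0) : ℝ × ℝ) ∘L
      lineDerivOpCLM ℂ 𝓢(ℝ × ℝ, ℂ) ((1, 0) : ℝ × ℝ))
    + momentumTwo b ∘L momentumTwo b

theorem momentumTwo_apply (b : ℝ) (u : 𝓢(ℝ × ℝ, ℂ)) (x : ℝ × ℝ) :
    momentumTwo b u x
      = -Complex.I * lineDeriv ℝ u x ((0, 1) : ℝ × ℝ) + ((b * x.1 : ℝ) : ℂ) * u x := by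
  have hg : Function.HasTemperateGrowth (fun x : ℝ × ℝ => ((b * x.1 : ℝ) : ℂ)) :=
    ((Complex.ofRealCLM.comp (b • ContinuousLinearMap.fst ℝ ℝ ℝ)).hasTemperateGrowth :)
  have h : smulLeftCLM ℂ (fun x : ℝ × ℝ => ((b * x.1 : ℝ) : ℂ)) u x
      = ((b * x.1 : ℝ) : ℂ) * u x := by
    rw [smulLeftCLM_apply_apply hg, smul_eq_mul]
  rw [← h, ← SchwartzMap.lineDerivOp_apply]
  simp [momentumTwo]

theorem landauSchwartz_apply (b : ℝ) (u : 𝓢(ℝ × ℝ, ℂ)) (x : ℝ × ℝ) :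
    landauSchwartz b u x
      = -lineDeriv ℝ (fun y => lineDeriv ℝ u y ((1, 0) : ℝ × ℝ)) x ((1, 0) : ℝ × ℝ)
        + momentumTwo b (momentumTwo b u) x := by
  have h : ((∂_{((1, 0) : ℝ × ℝ)} u : 𝓢(ℝ × ℝ, ℂ)) : ℝ × ℝ → ℂ)
      = fun y => lineDeriv ℝ u y ((1, 0) : ℝ × ℝ) := by
    funext y; exact SchwartzMap.lineDerivOp_apply _ _ _
  simp [landauSchwartz, SchwartzMap.lineDerivOp_apply, h]

/-- The pairs `(f, h)` in `L²(ℝ²) × L²(ℝ²)` such that `-∂₁² f + (-i ∂₂ + b x₁)² f = h` in the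
sense of (tempered) distributions; the differential expression is formally symmetric, so it is
moved to the test function inside the (sesquilinear) inner product. -/
def landauGraph (b : ℝ) : Submodule ℂ (L2Plane × L2Plane) where
  carrier := {p | ∀ u : 𝓢(ℝ × ℝ, ℂ),
    ⟪u.toLp 2 volume, p.2⟫_ℂ = ⟪(landauSchwartz b u).toLp 2 volume, p.1⟫_ℂ}
  zero_mem' := by intro u; simp
  add_mem' := by
    intro p q hp hq u
    simp only [Prod.fst_add, Prod.snd_add, inner_add_right]
    rw [hp u, hq u]
  smul_mem' := by
    intro c p hp u
    simp only [Prod.smul_fst, Prod.smul_snd, inner_smul_right]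
    rw [hp u]

/-- The Landau operator `-∂₁² + (-i ∂₂ + b x₁)²` in `L²(ℝ²)`, on its maximal domain: all `f` in
`L²(ℝ²)` whose image in the sense of distributions is again in `L²(ℝ²)`. -/
def landauOperator (b : ℝ) : L2Plane →ₗ.[ℂ] L2Plane := (landauGraph b).toLinearPMap

theorem landauGraph_single_valued (b : ℝ) (p : L2Plane × L2Plane) (hp : p ∈ landauGraph b)
    (h0 : p.1 = 0) : p.2 = 0 := by
  have hd := SchwartzMap.denseRange_toLpCLM (F := ℂ) (p := 2) (by norm_num)
    (μ := (volume : Measure (ℝ × ℝ)))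
  refine hd.eq_zero_of_inner_left (𝕜 := ℂ) ?_
  intro u
  rw [inner_eq_zero_symm]
  have := hp u
  rw [h0, inner_zero_right] at this
  simpa using this

theorem landauOperator_graph (b : ℝ) : (landauOperator b).graph = landauGraph b :=
  Submodule.toLinearPMap_graph_eq _ (landauGraph_single_valued b)

theorem mem_landauEigenspace_iff (b : ℝ) (z : ℂ) (f : L2Plane) :
    f ∈ pmapEigenspace (landauOperator b) z ↔ (f, z • f) ∈ landauGraph b := by
  rw [← landauOperator_graph, LinearPMap.mem_graph_iff]
  constructor
  · rintro ⟨hf, e⟩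
    exact ⟨⟨f, hf⟩, rfl, e⟩
  · rintro ⟨⟨y, hy⟩, e1, e2⟩
    subst e1
    exact ⟨hy, e2⟩

theorem isClosed_landauEigenspace (b : ℝ) (z : ℂ) :
    IsClosed (pmapEigenspace (landauOperator b) z : Set L2Plane) := by
  have : (pmapEigenspace (landauOperator b) z : Set L2Plane)
      = ⋂ u : 𝓢(ℝ × ℝ, ℂ), {f : L2Plane | ⟪u.toLp 2 volume, z • f⟫_ℂ
          = ⟪(landauSchwartz b u).toLp 2 volume, f⟫_ℂ} := by
    ext f
    rw [SetLike.mem_coe, mem_landauEigenspace_iff, Set.mem_iInter]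
    rfl
  rw [this]
  exact isClosed_iInter fun u => isClosed_eq (by fun_prop) (by fun_prop)

/-- Eigenspaces of the Landau operator are closed, so they have orthogonal projections. -/
instance instCompleteLandauEigenspace (b : ℝ) (z : ℂ) :
    CompleteSpace (pmapEigenspace (landauOperator b) z) :=
  (isClosed_landauEigenspace b z).completeSpace_coe

/-! ### Landau levels -/

/-- The (physicists') Hermite polynomial `(-1)ⁿ exp(x²) (d/dx)ⁿ exp(-x²)`. -/
def hermitePhys (n : ℕ) (x : ℝ) : ℝ :=
  (-1) ^ n * Real.exp (x ^ 2) * iteratedDeriv n (fun t : ℝ => Real.exp (-t ^ 2)) x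

/-- The rescaled Hermite function `φₙ`. -/
def hermiteFun (b : ℝ) (n : ℕ) (x : ℝ) : ℝ :=
  ((2 ^ n * (n.factorial : ℝ)) ^ (-(1 / 2) : ℝ) / Real.pi ^ (1 / 4 : ℝ)) * |b| ^ (1 / 4 : ℝ)
    * hermitePhys n (√|b| * x) * Real.exp (-(1 / 2) * |b| * x ^ 2)

/-- The integrand of the Wigner type transform. -/
def wignerIntegrand (b : ℝ) (φ g : ℝ → ℂ) (x : ℝ × ℝ) (k : ℝ) : ℂ :=
  Complex.exp (-Complex.I * k * x.2) * φ (x.1 - k / b) * g k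

/-- The Wigner type transform
`𝒲(φ, g)(x) = (2π)^(-1/2) ∫ exp(-i k x₂) φ(x₁ - k/b) g(k) dk`. -/
def wignerTransform (b : ℝ) (φ g : ℝ → ℂ) (x : ℝ × ℝ) : ℂ :=
  ((1 / √(2 * Real.pi) : ℝ) : ℂ) * ∫ k : ℝ, wignerIntegrand b φ g x k

/-- The integrand of the kernel of the projector on the `n`-th Landau level. -/
def landauKernelIntegrand (b : ℝ) (n : ℕ) (x y : ℝ × ℝ) (k : ℝ) : ℂ :=
  Complex.exp (-Complex.I * k * (x.2 - y.2))
    * (hermiteFun b n (x.1 - k / b) : ℂ) * (hermiteFun b n (y.1 - k / b) : ℂ)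

/-- The kernel
`Pₙ(x; y) = (2π)⁻¹ ∫ exp(-i k (x₂ - y₂)) φₙ(x₁ - k/b) φₙ(y₁ - k/b) dk`. -/
def landauKernel (b : ℝ) (n : ℕ) (x y : ℝ × ℝ) : ℂ :=
  ((1 / (2 * Real.pi) : ℝ) : ℂ) * ∫ k : ℝ, landauKernelIntegrand b n x y k

/-- The `n`-th Landau level `|b| (2n + 1)`. -/
def landauLevel (b : ℝ) (n : ℕ) : ℝ := |b| * (2 * n + 1)

/-- `P` is the integral operator with kernel `K`. -/
def HasIntegralKernel (P : L2Plane →L[ℂ] L2Plane) (K : ℝ × ℝ → ℝ × ℝ → ℂ) : Prop :=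
  ∀ f : L2Plane, (∀ x, Integrable (fun y => K x y * f y)) ∧
    P f =ᵐ[volume] fun x => ∫ y, K x y * f y

end

/-! On a plane wave `exp (-i k x₂) φ(x₁ - k / b)` the operator `-i ∂₂ + b x₁` acts as multiplication
by `b (x₁ - k / b)`, while `∂₁` differentiates `φ`. Hence `φ ↦ 𝒲(φ, g)` turns the oscillator
`-d²/dt² + b² t²` into the Landau operator, and its eigenfunctions `φₙ` give eigenvectors `𝒲(φₙ, g)`
at level `|b| (2n + 1)`, with `g` free (`inner_landauSchwartz_wignerCLM`). Plancherel in `x₂` and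
Tonelli give `‖𝒲(φ, g)‖ = ‖φ‖ ‖g‖` (`norm_wignerCLM`), so `Vₙ : g ↦ 𝒲(φₙ, g)` is an isometry.

Two facts complete the picture. The ranges of the `Vₙ` are total
(`eq_zero_of_forall_inner_wignerCLM`): Hermite functions are total on the line, and transforms of
Gaussians with complex drift are a nowhere vanishing Gaussian times arbitrary characters of the
plane. The maximal domain is not too large (`inner_wignerCLM_of_mem_landauGraph`): its defining
relation is tested on Schwartz functions only, but `𝒲(φₙ, g)` is Schwartz for a total family of `g`,
which extends the relation to all `𝒲(φₙ, g)`.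

Consequently, for a Hilbert basis `β` of `L²(ℝ)`, the vectors `Vₙ βₗ` form a Hilbert basis of
`L²(ℝ²)` in which the operator is the maximal multiplication by the real numbers `|b| (2n + 1)`.
Self-adjointness, pure point spectrum and the spectrum follow from the general theory of diagonal
operators. The projector is `Vₙ Vₙ*`, and writing `Vₙ*` out against plane waves gives its kernel. -/

open scoped FourierTransform ContDiff

noncomputable section

/-! ### Fourier uniqueness and Plancherel's identity. -/

section FourierUniqueness

variable {V : Type*} [NormedAddCommGroup V] [InnerProductSpace ℝ V] [FiniteDimensional ℝ V]
  [MeasurableSpace V] [BorelSpace V]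

/-- The Fourier transform moves from an integrable function to a Schwartz function. -/
theorem integral_schwartz_fourier_smul_eq (ψ : 𝓢(V, ℂ)) {f : V → ℂ} (hf : Integrable f) :
    ∫ x, 𝓕 (ψ : V → ℂ) x • f x = ∫ x, ψ x • 𝓕 f x := by
  have := VectorFourier.integral_fourierIntegral_smul_eq_flip (μ := (volume : Measure V))
    (ν := (volume : Measure V)) (L := innerₗ V) (e := Real.fourierChar) (f := ψ) (g := f)
    Real.continuous_fourierChar (by
      exact continuous_inner) ψ.integrable hf
  rw [flip_innerₗ] at this
  exact this

/-- A locally integrable function is determined by its integrals against Schwartz functions. -/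
theorem ae_eq_of_integral_schwartz_smul_eq {E : Type*} [NormedAddCommGroup E] [NormedSpace ℝ E]
    [FiniteDimensional ℝ E] [MeasurableSpace E] [BorelSpace E] {μ : Measure E} {f g : E → ℂ}
    (hf : LocallyIntegrable f μ) (hg : LocallyIntegrable g μ)
    (h : ∀ ψ : 𝓢(E, ℂ), ∫ x, ψ x • f x ∂μ = ∫ x, ψ x • g x ∂μ) : f =ᵐ[μ] g := by
  refine ae_eq_of_integral_contDiff_smul_eq hf hg fun u hu hc => ?_
  have hg₁ : HasCompactSupport (Complex.ofRealCLM ∘ u) := hc.comp_left rfl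
  have hg₂ : ContDiff ℝ ∞ (Complex.ofRealCLM ∘ u) := by fun_prop
  simpa using h (hg₁.toSchwartzMap hg₂)

/-- An integrable function with vanishing Fourier transform vanishes. -/
theorem ae_eq_zero_of_fourier_eq_zero {f : V → ℂ} (hf : Integrable f) (h : ∀ ξ, 𝓕 f ξ = 0) :
    f =ᵐ[volume] 0 := by
  refine ae_eq_of_integral_schwartz_smul_eq hf.locallyIntegrable
    (integrable_zero V ℂ volume).locallyIntegrable fun ψ => ?_
  have h1 : (ψ : V → ℂ) = 𝓕 ((𝓕⁻ ψ : 𝓢(V, ℂ)) : V → ℂ) := by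
    rw [← SchwartzMap.fourier_coe, FourierTransform.fourier_fourierInv_eq]
  rw [h1, integral_schwartz_fourier_smul_eq _ hf]
  simp [h]

end FourierUniqueness

/-- An integrable function on the line orthogonal to all characters vanishes. -/
theorem ae_eq_zero_of_forall_integral_exp_mul {f : ℝ → ℂ} (hf : Integrable f)
    (h : ∀ ξ : ℝ, ∫ t : ℝ, Complex.exp (Complex.I * ξ * t) * f t = 0) : f =ᵐ[volume] 0 := by
  refine ae_eq_zero_of_fourier_eq_zero hf fun ξ => ?_
  rw [Real.fourier_real_eq_integral_exp_smul, ← h (-2 * Real.pi * ξ)]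
  congr with t
  rw [smul_eq_mul]
  congr 2
  push_cast
  ring

/-- An integrable function on the plane orthogonal to all characters vanishes. -/
theorem ae_eq_zero_of_forall_integral_exp_mul_plane {f : ℝ × ℝ → ℂ} (hf : Integrable f)
    (h : ∀ ξ η : ℝ, ∫ x : ℝ × ℝ, Complex.exp (Complex.I * (ξ * x.1 + η * x.2)) * f x = 0) :
    f =ᵐ[volume] 0 := by
  -- `ℝ × ℝ` carries the sup norm, which comes from no inner product, so the function is transported
  -- to `ℂ`.
  have hmp := Complex.volume_preserving_equiv_real_prod
  have key : (f ∘ Complex.measurableEquivRealProd) =ᵐ[volume] 0 := by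
    refine ae_eq_zero_of_fourier_eq_zero ?_ fun ξ => ?_
    · exact hmp.integrable_comp_of_integrable hf
    · rw [Real.fourier_eq', ← h (-2 * Real.pi * ξ.re) (-2 * Real.pi * ξ.im),
        ← hmp.integral_comp Complex.measurableEquivRealProd.measurableEmbedding]
      congr with z
      simp only [smul_eq_mul, Function.comp_apply]
      congr 2
      simp [Complex.measurableEquivRealProd, Complex.inner]
      ring
  have h2 := hmp.symm.quasiMeasurePreserving.ae_eq_comp key
  filter_upwards [h2] with x hx
  simpa using hx

/-- Plancherel's identity for functions that are both integrable and square integrable. -/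
theorem lintegral_enorm_sq_fourier {f : ℝ → ℂ} (hf : Integrable f) (hf2 : MemLp f 2) :
    ∫⁻ ξ, ‖𝓕 f ξ‖ₑ ^ 2 = ∫⁻ t, ‖f t‖ₑ ^ 2 := by
  -- The `L²` Fourier transform and the Fourier integral define the same tempered distribution; the
  -- isometry property of the former then passes to the latter.
  have hae : ((𝓕 (hf2.toLp f) : Lp ℂ 2 (volume : Measure ℝ)) : ℝ → ℂ) =ᵐ[volume] 𝓕 f := by
    refine ae_eq_of_integral_schwartz_smul_eq
      ((Lp.memLp _).locallyIntegrable (by norm_num)) ?_ fun ψ => ?_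
    · exact (VectorFourier.fourierIntegral_continuous Real.continuous_fourierChar
        (by exact continuous_inner) hf).locallyIntegrable
    · have h1 := congrArg (fun T => T ψ) (Lp.fourier_toTemperedDistribution_eq (hf2.toLp f))
      simp only [TemperedDistribution.fourier_apply, Lp.toTemperedDistribution_apply] at h1
      rw [← h1, ← integral_schwartz_fourier_smul_eq _ hf, ← SchwartzMap.fourier_coe]
      refine integral_congr_ae ?_
      filter_upwards [hf2.coeFn_toLp] with x hx
      rw [hx]
  have e1 := Lp.norm_fourier_eq (hf2.toLp f)
  have e2 : eLpNorm (𝓕 f) 2 volume = eLpNorm f 2 volume := by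
    rw [← eLpNorm_congr_ae hae, ← eLpNorm_congr_ae hf2.coeFn_toLp, ← Lp.enorm_def, ← Lp.enorm_def,
      ← ofReal_norm, e1, ofReal_norm]
  rw [eLpNorm_eq_lintegral_rpow_enorm_toReal (p := 2) (by norm_num) (by norm_num),
    eLpNorm_eq_lintegral_rpow_enorm_toReal (p := 2) (by norm_num) (by norm_num)] at e2
  simpa using ENNReal.rpow_left_injective (by norm_num) e2

/-! ### Gaussians -/

/-- On monomials it follows from `|x| ^ m ≤ m! exp |x|` and `|x| - x² / 2 ≤ 1 / 2`. It supplies the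
decay of `gaussianSchwartz`, whose derivatives are Hermite polynomials times the Gaussian. -/
theorem exists_bound_polynomial_mul_gaussian (p : Polynomial ℝ) :
    ∃ C : ℝ, ∀ x : ℝ, |p.eval x| * Real.exp (-(x ^ 2 / 2)) ≤ C := by
  induction p using Polynomial.induction_on' with
  | add p q hp hq =>
    obtain ⟨C, hC⟩ := hp
    obtain ⟨D, hD⟩ := hq
    refine ⟨C + D, fun x => ?_⟩
    rw [Polynomial.eval_add]
    have := mul_le_mul_of_nonneg_right (abs_add_le (p.eval x) (q.eval x))
      (Real.exp_pos (-(x ^ 2 / 2))).le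
    linarith [hC x, hD x]
  | monomial m a =>
    refine ⟨|a| * (m.factorial * Real.exp (1 / 2)), fun x => ?_⟩
    rw [Polynomial.eval_monomial, abs_mul, abs_pow, mul_assoc]
    refine mul_le_mul_of_nonneg_left ?_ (abs_nonneg a)
    have h1 := Real.pow_div_factorial_le_exp |x| (abs_nonneg x) m
    rw [div_le_iff₀ (by positivity)] at h1
    have h2 : |x| + -(x ^ 2 / 2) ≤ 1 / 2 := by nlinarith [sq_abs x, sq_nonneg (|x| - 1)]
    calc |x| ^ m * Real.exp (-(x ^ 2 / 2))
        ≤ Real.exp |x| * m.factorial * Real.exp (-(x ^ 2 / 2)) := by gcongr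
      _ = m.factorial * Real.exp (|x| + -(x ^ 2 / 2)) := by rw [Real.exp_add]; ring
      _ ≤ _ := by gcongr

/-- The standard Gaussian as a Schwartz function. -/
def gaussianSchwartz : 𝓢(ℝ, ℝ) where
  toFun x := Real.exp (-(x ^ 2 / 2))
  smooth' := by fun_prop
  decay' := by
    intro k n
    obtain ⟨C, hC⟩ := exists_bound_polynomial_mul_gaussian
      (Polynomial.X ^ k * (Polynomial.hermite n).map (Int.castRingHom ℝ))
    refine ⟨C, fun x => ?_⟩
    rw [norm_iteratedFDeriv_eq_norm_iteratedDeriv, iteratedDeriv_eq_iterate,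
      Polynomial.deriv_gaussian_eq_hermite_mul_gaussian]
    refine le_trans (le_of_eq ?_) (hC x)
    simp [abs_mul, Polynomial.aeval_def, Polynomial.eval_map, mul_assoc]

/-- The Gaussian `exp (-|x|² / 2)` of the plane as a Schwartz function. -/
def gaussianSchwartzPlane : 𝓢(ℝ × ℝ, ℝ) :=
  compCLMOfContinuousLinearEquiv ℝ Complex.equivRealProdCLM.symm
    -- `√(1 + ‖z‖²)` replaces `‖z‖` because it is smooth at the origin; this costs a factor `exp (-1
    -- / 2)`, restored in front.
    (Real.exp (1 / 2) • compCLM (𝕜 := ℝ) (g := fun z : ℂ => (1 + ‖z‖ ^ 2) ^ (1 / 2 : ℝ))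
      (Function.hasTemperateGrowth_one_add_norm_sq_rpow ℂ (1 / 2))
      ⟨1, 1, fun z => by
        have h : ‖z‖ ≤ (1 + ‖z‖ ^ 2) ^ (1 / 2 : ℝ) := by
          rw [← Real.sqrt_eq_rpow]
          exact Real.le_sqrt_of_sq_le (by linarith)
        rw [one_mul, pow_one, Real.norm_of_nonneg (by positivity)]
        linarith⟩ gaussianSchwartz)

theorem gaussianSchwartzPlane_apply (x : ℝ × ℝ) :
    gaussianSchwartzPlane x = Real.exp (-((x.1 ^ 2 + x.2 ^ 2) / 2)) := by
  have h : ((1 + ‖Complex.equivRealProdCLM.symm x‖ ^ 2) ^ (1 / 2 : ℝ)) ^ 2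
      = 1 + (x.1 ^ 2 + x.2 ^ 2) := by
    rw [← Real.sqrt_eq_rpow, Real.sq_sqrt (by positivity), Complex.sq_norm, Complex.normSq_apply]
    simp
    ring
  change Real.exp (1 / 2)
    * Real.exp (-(((1 + ‖Complex.equivRealProdCLM.symm x‖ ^ 2) ^ (1 / 2 : ℝ)) ^ 2 / 2)) = _
  rw [h, ← Real.exp_add]
  congr 1
  ring

theorem memLp_cexp_quadratic {a : ℝ} (ha : 0 < a) (v : ℂ) :
    MemLp (fun t : ℝ => Complex.exp (-(a / 2 : ℝ) * t ^ 2 + v * t)) 2 := by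
  rw [memLp_two_iff_integrable_sq_norm (by fun_prop)]
  have := (integrable_cexp_quadratic' (b := -(a : ℂ)) (by simpa using ha) (2 * v.re : ℝ) 0).norm
  refine this.congr (Filter.Eventually.of_forall fun t => ?_)
  simp only [Complex.norm_exp, ← Real.exp_nat_mul]
  congr 1
  simp [← Complex.ofReal_pow]
  ring

/-! ### Hermite functions -/

/-- Multiplication by the variable on Schwartz functions of the line. -/
def positionCLM : 𝓢(ℝ, ℂ) →L[ℂ] 𝓢(ℝ, ℂ) := smulLeftCLM ℂ (fun t : ℝ => (t : ℂ))

theorem positionCLM_apply (f : 𝓢(ℝ, ℂ)) (t : ℝ) : positionCLM f t = t * f t := by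
  rw [positionCLM, smulLeftCLM_apply_apply (by fun_prop), smul_eq_mul]

theorem derivCLM_positionCLM (f : 𝓢(ℝ, ℂ)) :
    derivCLM ℂ ℂ (positionCLM f) = positionCLM (derivCLM ℂ ℂ f) + f := by
  ext t
  have h : (positionCLM f : ℝ → ℂ) = fun t : ℝ => (t : ℂ) * f t := funext (positionCLM_apply f)
  have h1 : HasDerivAt (fun t : ℝ => (t : ℂ) * f t) (1 * f t + t * deriv f t) t :=
    HasDerivAt.mul (Complex.ofRealCLM.hasDerivAt (x := t)) (f.hasDerivAt t)
  rw [derivCLM_apply, h, h1.deriv, add_apply, positionCLM_apply, derivCLM_apply]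
  ring

/-- The normalization constant of the ladder operators. -/
def ladderCoeff (b : ℝ) (n : ℕ) : ℝ := √(2 * |b| * n)

theorem ladderCoeff_sq (b : ℝ) (n : ℕ) : ladderCoeff b n ^ 2 = 2 * |b| * n :=
  Real.sq_sqrt (by positivity)

theorem ladderCoeff_pos {b : ℝ} (hb : b ≠ 0) (n : ℕ) : 0 < ladderCoeff b (n + 1) :=
  Real.sqrt_pos.2 (by positivity)

/-- The raising operator `|b| t - d/dt`. -/
def raiseCLM (b : ℝ) : 𝓢(ℝ, ℂ) →L[ℂ] 𝓢(ℝ, ℂ) := ((|b| : ℝ) : ℂ) • positionCLM - derivCLM ℂ ℂ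

/-- The lowering operator `|b| t + d/dt`. -/
def lowerCLM (b : ℝ) : 𝓢(ℝ, ℂ) →L[ℂ] 𝓢(ℝ, ℂ) := ((|b| : ℝ) : ℂ) • positionCLM + derivCLM ℂ ℂ

theorem raiseCLM_apply (b : ℝ) (f : 𝓢(ℝ, ℂ)) :
    raiseCLM b f = ((|b| : ℝ) : ℂ) • positionCLM f - derivCLM ℂ ℂ f := rfl

theorem lowerCLM_apply (b : ℝ) (f : 𝓢(ℝ, ℂ)) :
    lowerCLM b f = ((|b| : ℝ) : ℂ) • positionCLM f + derivCLM ℂ ℂ f := rfl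

theorem lowerCLM_raiseCLM (b : ℝ) (f : 𝓢(ℝ, ℂ)) :
    lowerCLM b (raiseCLM b f) = raiseCLM b (lowerCLM b f) + (2 * |b| : ℂ) • f := by
  simp only [lowerCLM_apply, raiseCLM_apply, map_sub, map_add, map_smul, derivCLM_positionCLM]
  module

/-- The oscillator factorizes up to the zero-point energy `|b|`, so its eigenvalues can be read off
from the ladder relations. -/
theorem oscillator_eq (b : ℝ) (f : 𝓢(ℝ, ℂ)) :
    -derivCLM ℂ ℂ (derivCLM ℂ ℂ f) + ((b ^ 2 : ℝ) : ℂ) • positionCLM (positionCLM f)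
      = raiseCLM b (lowerCLM b f) + ((|b| : ℝ) : ℂ) • f := by
  have h : ((b ^ 2 : ℝ) : ℂ) = ((|b| : ℝ) : ℂ) * ((|b| : ℝ) : ℂ) := by
    rw [← Complex.ofReal_mul, abs_mul_abs_self, sq]
  simp only [lowerCLM_apply, raiseCLM_apply, map_add, map_smul, derivCLM_positionCLM, h]
  module

/-- The Gaussian `exp (-|b| t² / 2)` as a Schwartz function. -/
def groundSchwartz (b : ℝ) (hb : b ≠ 0) : 𝓢(ℝ, ℂ) :=
  postcompCLM Complex.ofRealCLM (compCLMOfContinuousLinearEquiv ℝ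
    (ContinuousLinearEquiv.unitsEquivAut ℝ (Units.mk0 (√|b|) (by positivity))) gaussianSchwartz)

theorem groundSchwartz_apply (b : ℝ) (hb : b ≠ 0) (t : ℝ) :
    groundSchwartz b hb t = (Real.exp (-(1 / 2) * |b| * t ^ 2) : ℂ) := by
  change ((Real.exp (-((t * √|b|) ^ 2 / 2)) : ℝ) : ℂ) = _
  rw [mul_pow, Real.sq_sqrt (abs_nonneg b)]
  congr 2
  ring

/-- The normalization constant of the Hermite functions. -/
def hermiteCoeff (b : ℝ) (n : ℕ) : ℝ :=
  ((2 ^ n * (n.factorial : ℝ)) ^ (-(1 / 2) : ℝ) / Real.pi ^ (1 / 4 : ℝ)) * |b| ^ (1 / 4 : ℝ)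

theorem hermiteCoeff_pos {b : ℝ} (hb : b ≠ 0) (n : ℕ) : 0 < hermiteCoeff b n := by
  unfold hermiteCoeff
  positivity

/-- The ratio of consecutive coefficients is `1 / √(2 (n + 1))`; the remaining `√|b|` is the chain
rule factor of `hermitePhys n (√|b| * x)`. -/
theorem hermiteCoeff_succ (b : ℝ) (n : ℕ) :
    ladderCoeff b (n + 1) * hermiteCoeff b (n + 1) = √|b| * hermiteCoeff b n := by
  have h1 : (0 : ℝ) < 2 * (n + 1) := by positivity
  have h2 : (2 ^ (n + 1) * ((n + 1).factorial : ℝ)) ^ (-(1 / 2) : ℝ)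
      = (√(2 * (n + 1)))⁻¹ * (2 ^ n * (n.factorial : ℝ)) ^ (-(1 / 2) : ℝ) := by
    rw [Real.sqrt_eq_rpow, ← Real.rpow_neg h1.le, ← Real.mul_rpow h1.le (by positivity),
      Nat.factorial_succ]
    congr 1
    push_cast
    ring
  have h3 : ladderCoeff b (n + 1) = √|b| * √(2 * (n + 1)) := by
    rw [ladderCoeff, ← Real.sqrt_mul (abs_nonneg b)]
    congr 1
    push_cast
    ring
  have h4 : √(2 * ((n : ℝ) + 1)) ≠ 0 := by positivity
  rw [h3, hermiteCoeff, hermiteCoeff, h2]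
  field_simp

/-- The Hermite functions as Schwartz functions. -/
def hermiteSchwartz (b : ℝ) (hb : b ≠ 0) : ℕ → 𝓢(ℝ, ℂ)
  | 0 => ((hermiteCoeff b 0 : ℝ) : ℂ) • groundSchwartz b hb
  | n + 1 => ((ladderCoeff b (n + 1) : ℝ) : ℂ)⁻¹ • raiseCLM b (hermiteSchwartz b hb n)

theorem hermitePhys_zero (x : ℝ) : hermitePhys 0 x = 1 := by
  simp [hermitePhys, ← Real.exp_add]

theorem hasDerivAt_hermitePhys (n : ℕ) (x : ℝ) :
    HasDerivAt (hermitePhys n) (2 * x * hermitePhys n x - hermitePhys (n + 1) x) x := by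
  have h : ContDiff ℝ ⊤ (fun t : ℝ => Real.exp (-t ^ 2)) := by fun_prop
  have h1 : HasDerivAt (iteratedDeriv n (fun t : ℝ => Real.exp (-t ^ 2)))
      (iteratedDeriv (n + 1) (fun t : ℝ => Real.exp (-t ^ 2)) x) x := by
    rw [iteratedDeriv_succ]
    exact ((h.differentiable_iteratedDeriv n (by exact_mod_cast WithTop.coe_lt_top _)) x).hasDerivAt
  have h2 : HasDerivAt (fun x : ℝ => (-1) ^ n * Real.exp (x ^ 2))
      ((-1) ^ n * (Real.exp (x ^ 2) * (2 * x))) x := by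
    simpa using ((hasDerivAt_pow 2 x).exp).const_mul ((-1) ^ n)
  refine (h2.mul h1).congr_deriv ?_
  simp only [hermitePhys, pow_succ]
  ring

theorem hermiteFun_eq (b : ℝ) (n : ℕ) (x : ℝ) : hermiteFun b n x
    = hermiteCoeff b n * hermitePhys n (√|b| * x) * Real.exp (-(1 / 2) * |b| * x ^ 2) := rfl

/-- This is the raising relation for the explicit functions; through it `hermiteSchwartz_apply`
identifies them with the recursively defined ones. -/
theorem hasDerivAt_hermiteFun (b : ℝ) (n : ℕ) (x : ℝ) :
    HasDerivAt (hermiteFun b n)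
      (|b| * x * hermiteFun b n x - ladderCoeff b (n + 1) * hermiteFun b (n + 1) x) x := by
  have h1 : HasDerivAt (fun x => hermitePhys n (√|b| * x)) ((2 * (√|b| * x)
      * hermitePhys n (√|b| * x) - hermitePhys (n + 1) (√|b| * x)) * √|b|) x :=
    HasDerivAt.comp x (hasDerivAt_hermitePhys n (√|b| * x))
      (by simpa using (hasDerivAt_id x).const_mul (√|b|))
  have h2 : HasDerivAt (fun x => Real.exp (-(1 / 2) * |b| * x ^ 2))
      (Real.exp (-(1 / 2) * |b| * x ^ 2) * (-|b| * x)) x := by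
    refine (((hasDerivAt_pow 2 x).const_mul (-(1 / 2) * |b|)).exp).congr_deriv ?_
    simp
    ring
  refine (((h1.const_mul (hermiteCoeff b n)).mul h2)).congr_deriv ?_
  have h3 : √|b| * √|b| = |b| := Real.mul_self_sqrt (abs_nonneg b)
  rw [hermiteFun_eq, hermiteFun_eq]
  linear_combination (2 * hermiteCoeff b n * x * hermitePhys n (√|b| * x)
    * Real.exp (-(1 / 2) * |b| * x ^ 2)) * h3
    + hermitePhys (n + 1) (√|b| * x) * Real.exp (-(1 / 2) * |b| * x ^ 2) * hermiteCoeff_succ b n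

theorem hermiteSchwartz_apply (b : ℝ) (hb : b ≠ 0) (n : ℕ) (t : ℝ) :
    hermiteSchwartz b hb n t = (hermiteFun b n t : ℂ) := by
  induction n generalizing t with
  | zero =>
    rw [hermiteFun_eq, hermitePhys_zero, hermiteSchwartz, smul_apply, groundSchwartz_apply]
    push_cast
    rw [smul_eq_mul, mul_one]
  | succ n ih =>
    have h1 : (hermiteSchwartz b hb n : ℝ → ℂ) = fun t => (hermiteFun b n t : ℂ) := funext ih
    have h2 := (hasDerivAt_hermiteFun b n t).ofReal_comp
    have h3 : ((ladderCoeff b (n + 1) : ℝ) : ℂ) ≠ 0 := by exact_mod_cast (ladderCoeff_pos hb n).ne'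
    rw [hermiteSchwartz, smul_apply, raiseCLM_apply, sub_apply, smul_apply, positionCLM_apply,
      derivCLM_apply, ih, h1, h2.deriv, smul_eq_mul, inv_mul_eq_iff_eq_mul₀ h3, smul_eq_mul]
    push_cast
    ring

theorem raiseCLM_hermiteSchwartz (b : ℝ) (hb : b ≠ 0) (n : ℕ) :
    raiseCLM b (hermiteSchwartz b hb n)
      = ((ladderCoeff b (n + 1) : ℝ) : ℂ) • hermiteSchwartz b hb (n + 1) := by
  have h3 : ((ladderCoeff b (n + 1) : ℝ) : ℂ) ≠ 0 := by exact_mod_cast (ladderCoeff_pos hb n).ne'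
  rw [hermiteSchwartz, smul_inv_smul₀ h3]

theorem lowerCLM_groundSchwartz (b : ℝ) (hb : b ≠ 0) : lowerCLM b (groundSchwartz b hb) = 0 := by
  ext t
  have h1 : (groundSchwartz b hb : ℝ → ℂ)
      = fun t : ℝ => ((Real.exp (-(1 / 2) * |b| * t ^ 2) : ℝ) : ℂ) := by
    funext t
    rw [groundSchwartz_apply]
  have h2 : HasDerivAt (fun x => Real.exp (-(1 / 2) * |b| * x ^ 2))
      (Real.exp (-(1 / 2) * |b| * t ^ 2) * (-|b| * t)) t := by
    refine (((hasDerivAt_pow 2 t).const_mul (-(1 / 2) * |b|)).exp).congr_deriv ?_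
    simp
    ring
  rw [lowerCLM_apply, add_apply, smul_apply, positionCLM_apply, derivCLM_apply, h1,
    h2.ofReal_comp.deriv]
  simp
  ring

theorem lowerCLM_hermiteSchwartz_zero (b : ℝ) (hb : b ≠ 0) :
    lowerCLM b (hermiteSchwartz b hb 0) = 0 := by
  rw [hermiteSchwartz, map_smul, lowerCLM_groundSchwartz, smul_zero]

/-- Lowering after raising is raising after lowering plus `2 |b|`, so each step up adds `2 |b|` to
the squared ladder coefficient. -/
theorem lowerCLM_hermiteSchwartz_succ (b : ℝ) (hb : b ≠ 0) (n : ℕ) :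
    lowerCLM b (hermiteSchwartz b hb (n + 1))
      = ((ladderCoeff b (n + 1) : ℝ) : ℂ) • hermiteSchwartz b hb n := by
  have h3 : ((ladderCoeff b (n + 1) : ℝ) : ℂ) ≠ 0 := by exact_mod_cast (ladderCoeff_pos hb n).ne'
  have h4 : ∀ m : ℕ, ((ladderCoeff b m : ℝ) : ℂ) * (ladderCoeff b m : ℝ) = 2 * |b| * m := by
    intro m
    rw [← Complex.ofReal_mul, ← sq, ladderCoeff_sq]
    push_cast
    ring
  rw [hermiteSchwartz, map_smul, lowerCLM_raiseCLM, inv_smul_eq_iff₀ h3, smul_smul, h4]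
  induction n with
  | zero => simp [lowerCLM_hermiteSchwartz_zero]
  | succ n ih =>
    -- The induction runs on the unnormalized identity, so the lowering relation one step below has
    -- to be recovered from `ih` as `h6`.
    have h5 : ((ladderCoeff b (n + 1) : ℝ) : ℂ) ≠ 0 := by
      exact_mod_cast (ladderCoeff_pos hb n).ne'
    have h6 : lowerCLM b (hermiteSchwartz b hb (n + 1))
        = ((ladderCoeff b (n + 1) : ℝ) : ℂ) • hermiteSchwartz b hb n := by
      rw [hermiteSchwartz, map_smul, lowerCLM_raiseCLM, inv_smul_eq_iff₀ h5, smul_smul, h4,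
        ih h5]
    rw [h6, map_smul, raiseCLM_hermiteSchwartz, smul_smul, h4]
    push_cast
    module

/-- The Hermite functions are eigenfunctions of the harmonic oscillator. -/
theorem oscillator_hermiteSchwartz (b : ℝ) (hb : b ≠ 0) (n : ℕ) :
    -derivCLM ℂ ℂ (derivCLM ℂ ℂ (hermiteSchwartz b hb n))
        + ((b ^ 2 : ℝ) : ℂ) • positionCLM (positionCLM (hermiteSchwartz b hb n))
      = ((landauLevel b n : ℝ) : ℂ) • hermiteSchwartz b hb n := by
  rw [oscillator_eq]
  cases n with
  | zero =>
    rw [lowerCLM_hermiteSchwartz_zero, map_zero, zero_add, landauLevel]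
    simp
  | succ n =>
    rw [lowerCLM_hermiteSchwartz_succ, map_smul, raiseCLM_hermiteSchwartz, smul_smul,
      ← Complex.ofReal_mul, ← sq, ladderCoeff_sq, ← add_smul, landauLevel]
    push_cast
    congr 1
    ring

/-- The sum of the raising and lowering operators is `2 |b| t`. This places every `t ^ j φ₀` in the
span of the Hermite functions. -/
theorem positionCLM_hermiteSchwartz_mem (b : ℝ) (hb : b ≠ 0) {f : 𝓢(ℝ, ℂ)}
    (hf : f ∈ Submodule.span ℂ (Set.range (hermiteSchwartz b hb))) :
    positionCLM f ∈ Submodule.span ℂ (Set.range (hermiteSchwartz b hb)) := by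
  induction hf using Submodule.span_induction with
  | zero => rw [map_zero]; exact Submodule.zero_mem _
  | add f g _ _ hf hg => rw [map_add]; exact Submodule.add_mem _ hf hg
  | smul c f _ hf => rw [map_smul]; exact Submodule.smul_mem _ c hf
  | mem f hf =>
    obtain ⟨n, rfl⟩ := hf
    have h0 : (2 * |b| : ℂ) ≠ 0 := by simpa using hb
    have h1 : positionCLM (hermiteSchwartz b hb n) = (2 * |b| : ℂ)⁻¹ •
        (raiseCLM b (hermiteSchwartz b hb n) + lowerCLM b (hermiteSchwartz b hb n)) := by
      rw [eq_inv_smul_iff₀ h0, raiseCLM_apply, lowerCLM_apply]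
      module
    have hm : ∀ m, hermiteSchwartz b hb m
        ∈ Submodule.span ℂ (Set.range (hermiteSchwartz b hb)) := fun m =>
      Submodule.subset_span ⟨m, rfl⟩
    rw [h1]
    refine Submodule.smul_mem _ _ (Submodule.add_mem _ ?_ ?_)
    · rw [raiseCLM_hermiteSchwartz]
      exact Submodule.smul_mem _ _ (hm _)
    · cases n with
      | zero => rw [lowerCLM_hermiteSchwartz_zero]; exact Submodule.zero_mem _
      | succ n =>
        rw [lowerCLM_hermiteSchwartz_succ]
        exact Submodule.smul_mem _ _ (hm _)

/-! ### Normalization and totality of the Hermite functions. -/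

theorem integral_raiseCLM_mul (b : ℝ) (f g : 𝓢(ℝ, ℂ)) :
    ∫ t, raiseCLM b f t * g t = ∫ t, f t * lowerCLM b g t := by
  have h := integral_mul_deriv_eq_neg_deriv_mul f g
  have e1 : ∀ t, raiseCLM b f t * g t = ((|b| : ℝ) : ℂ) * (positionCLM f t * g t) - deriv f t * g t := by
    intro t
    simp [raiseCLM_apply]
    ring
  have e2 : ∀ t, f t * lowerCLM b g t = ((|b| : ℝ) : ℂ) * (positionCLM f t * g t) + f t * deriv g t := by
    intro t
    simp [lowerCLM_apply, positionCLM_apply]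
    ring
  have i1 : Integrable fun t => ((|b| : ℝ) : ℂ) * (positionCLM f t * g t) :=
    (pairing (ContinuousLinearMap.mul ℂ ℂ) (positionCLM f) g).integrable.const_mul _
  have i2 : Integrable fun t => deriv f t * g t :=
    (pairing (ContinuousLinearMap.mul ℂ ℂ) (derivCLM ℂ ℂ f) g).integrable
  have i3 : Integrable fun t => f t * deriv g t :=
    (pairing (ContinuousLinearMap.mul ℂ ℂ) f (derivCLM ℂ ℂ g)).integrable
  simp only [e1, e2]
  rw [integral_sub i1 i2, integral_add i1 i3, h]
  ring

/-- Raising and lowering are transposes of each other with the same ladder coefficient, so the norm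
does not change with `n`; for `n = 0` it is a Gaussian integral. No conjugate is needed since the
functions are real. -/
theorem integral_hermiteSchwartz_mul_self (b : ℝ) (hb : b ≠ 0) (n : ℕ) :
    ∫ t, hermiteSchwartz b hb n t * hermiteSchwartz b hb n t = 1 := by
  induction n with
  | zero =>
    have h1 : ∀ t, hermiteSchwartz b hb 0 t * hermiteSchwartz b hb 0 t
        = ((hermiteCoeff b 0 ^ 2 * Real.exp (-|b| * t ^ 2) : ℝ) : ℂ) := by
      intro t
      rw [hermiteSchwartz_apply, ← Complex.ofReal_mul, hermiteFun_eq, hermitePhys_zero]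
      congr 1
      have : Real.exp (-|b| * t ^ 2)
          = Real.exp (-(1 / 2) * |b| * t ^ 2) * Real.exp (-(1 / 2) * |b| * t ^ 2) := by
        rw [← Real.exp_add]
        congr 1
        ring
      rw [this]
      ring
    have hp := Real.pi_pos
    have hb' : 0 < |b| := abs_pos.2 hb
    simp only [h1]
    rw [integral_complex_ofReal, integral_const_mul, integral_gaussian]
    have h2 : hermiteCoeff b 0 ^ 2 = √|b| / √Real.pi := by
      have h4 : ∀ x : ℝ, 0 ≤ x → (x ^ (1 / 4 : ℝ)) ^ 2 = √x := by
        intro x hx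
        rw [← Real.rpow_natCast, ← Real.rpow_mul hx, Real.sqrt_eq_rpow]
        norm_num
      rw [hermiteCoeff, mul_pow, div_pow, h4 _ hp.le, h4 _ hb'.le]
      simp
      ring
    rw [h2, Real.sqrt_div hp.le]
    have h5 : √|b| ≠ 0 := by positivity
    have h6 : √Real.pi ≠ 0 := by positivity
    rw [div_mul_div_cancel₀ h6, div_self h5, Complex.ofReal_one]
  | succ n ih =>
    have h3 : ((ladderCoeff b (n + 1) : ℝ) : ℂ) ≠ 0 := by exact_mod_cast (ladderCoeff_pos hb n).ne'
    have h := integral_raiseCLM_mul b (hermiteSchwartz b hb n) (hermiteSchwartz b hb (n + 1))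
    rw [raiseCLM_hermiteSchwartz, lowerCLM_hermiteSchwartz_succ] at h
    simp only [smul_apply, smul_eq_mul, mul_assoc, mul_left_comm _ ((ladderCoeff b (n + 1) : ℝ) : ℂ),
      integral_const_mul] at h
    rw [← ih]
    exact mul_left_cancel₀ h3 h

/-- The Hermite functions are total in `L²(ℝ)`. -/
theorem ae_eq_zero_of_forall_integral_hermiteSchwartz_mul (b : ℝ) (hb : b ≠ 0) {f : ℝ → ℂ}
    (hf : MemLp f 2) (h : ∀ n, ∫ t, hermiteSchwartz b hb n t * f t = 0) : f =ᵐ[volume] 0 := by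
  have hi : ∀ ψ : 𝓢(ℝ, ℂ), Integrable fun t => ψ t * f t := fun ψ =>
    (ψ.memLp 2).integrable_mul hf
  have hspan : ∀ ψ ∈ Submodule.span ℂ (Set.range (hermiteSchwartz b hb)),
      ∫ t, ψ t * f t = 0 := by
    intro ψ hψ
    induction hψ using Submodule.span_induction with
    | zero => simp
    | add u v _ _ hu hv =>
      simp only [add_apply, add_mul]
      rw [integral_add (hi u) (hi v), hu, hv, add_zero]
    | smul c u _ hu =>
      simp only [smul_apply, smul_eq_mul, mul_assoc]
      rw [integral_const_mul, hu, mul_zero]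
    | mem u hu => obtain ⟨n, rfl⟩ := hu; exact h n
  have hpow : ∀ j : ℕ, positionCLM^[j] (hermiteSchwartz b hb 0)
      ∈ Submodule.span ℂ (Set.range (hermiteSchwartz b hb)) := by
    intro j
    induction j with
    | zero => exact Submodule.subset_span ⟨0, rfl⟩
    | succ j ih =>
      rw [Function.iterate_succ_apply']
      exact positionCLM_hermiteSchwartz_mem b hb ih
  have hpow_apply : ∀ (j : ℕ) (t : ℝ), (positionCLM^[j] (hermiteSchwartz b hb 0)) t
      = (t : ℂ) ^ j * hermiteSchwartz b hb 0 t := by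
    intro j
    induction j with
    | zero => intro t; simp
    | succ j ih =>
      intro t
      rw [Function.iterate_succ_apply', positionCLM_apply, ih, pow_succ]
      ring
  set ψ := hermiteSchwartz b hb 0 with hψ
  have hψ0 : ∀ t, ψ t = (hermiteCoeff b 0 : ℂ) * Complex.exp (-(|b| / 2 : ℝ) * t ^ 2) := by
    intro t
    rw [hψ, hermiteSchwartz, smul_apply, groundSchwartz_apply, smul_eq_mul, Complex.ofReal_exp]
    congr 2
    push_cast
    ring
  -- All moments of `ψ f` vanish. Expanding the character in its power series gives a vanishing
  -- Fourier transform, the exchange being dominated by `(exp (ξ t) + exp (-ξ t)) |ψ f|`, which is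
  -- integrable because `ψ` is Gaussian. Finally `ψ` has no zeros.
  have hzero : (fun t => ψ t * f t) =ᵐ[volume] 0 := by
    refine ae_eq_zero_of_forall_integral_exp_mul (hi ψ) fun ξ => ?_
    have hb' : 0 < |b| := abs_pos.2 hb
    have hexp : ∀ v : ℝ, Integrable fun t : ℝ => Complex.exp (v * t) * (ψ t * f t) := by
      intro v
      have := ((memLp_cexp_quadratic hb' v).integrable_mul hf).const_mul (hermiteCoeff b 0 : ℂ)
      refine this.congr (Filter.Eventually.of_forall fun t => ?_)
      simp only [Pi.mul_apply, hψ0, Complex.exp_add]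
      ring
    have hsum := hasSum_integral_of_dominated_convergence
      (F := fun (j : ℕ) (t : ℝ) => (Complex.I * ξ * t) ^ j / (j.factorial : ℂ) * (ψ t * f t))
      (f := fun t : ℝ => Complex.exp (Complex.I * ξ * t) * (ψ t * f t)) (μ := volume)
      (fun j t => |ξ * t| ^ j / j.factorial * ‖ψ t * f t‖) ?_ ?_ ?_ ?_ ?_
    · refine hsum.unique ?_
      convert! hasSum_zero with j
      have : ∀ t : ℝ, (Complex.I * ξ * t) ^ j / (j.factorial : ℂ) * (ψ t * f t)
          = (Complex.I * ξ) ^ j / (j.factorial : ℂ)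
            * ((positionCLM^[j] (hermiteSchwartz b hb 0)) t * f t) := by
        intro t
        rw [hpow_apply]
        ring
      simp only [this]
      rw [integral_const_mul, hspan _ (hpow j), mul_zero]
    · intro j
      exact ((by fun_prop : Continuous fun t : ℝ =>
        (Complex.I * ξ * t) ^ j / (j.factorial : ℂ)).aestronglyMeasurable).mul
          (hi ψ).aestronglyMeasurable
    · intro j
      refine Filter.Eventually.of_forall fun t => le_of_eq ?_
      simp [abs_mul]
    · exact Filter.Eventually.of_forall fun t =>
        (Real.summable_pow_div_factorial |ξ * t|).mul_right _
    · have : ∀ t : ℝ, ∑' j : ℕ, |ξ * t| ^ j / j.factorial * ‖ψ t * f t‖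
          = Real.exp |ξ * t| * ‖ψ t * f t‖ := by
        intro t
        rw [tsum_mul_right, Real.exp_eq_exp_ℝ, NormedSpace.exp_eq_tsum_div]
      simp only [this]
      refine ((hexp ξ).norm.add (hexp (-ξ)).norm).mono' ?_ (Filter.Eventually.of_forall fun t => ?_)
      · exact ((by fun_prop : Continuous fun t : ℝ => Real.exp |ξ * t|).aestronglyMeasurable).mul
          (hi ψ).aestronglyMeasurable.norm
      · have e : Real.exp |ξ * t| ≤ Real.exp (ξ * t) + Real.exp (-(ξ * t)) := by
          rcases abs_cases (ξ * t) with ⟨h, -⟩ | ⟨h, -⟩ <;> rw [h] <;>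
            linarith [Real.exp_pos (ξ * t), Real.exp_pos (-(ξ * t))]
        have := mul_le_mul_of_nonneg_right e (norm_nonneg (ψ t * f t))
        simp only [Pi.add_apply, norm_mul (Complex.exp _), Complex.norm_exp]
        rw [Real.norm_of_nonneg (by positivity)]
        simpa [add_mul] using this
    · refine Filter.Eventually.of_forall fun t => ?_
      have := NormedSpace.expSeries_div_hasSum_exp (𝔸 := ℂ) (Complex.I * ξ * t)
      rw [← Complex.exp_eq_exp_ℂ] at this
      exact this.mul_right _
  filter_upwards [hzero] with t ht
  have : ψ t ≠ 0 := by
    rw [hψ0]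
    exact mul_ne_zero (by exact_mod_cast (hermiteCoeff_pos hb 0).ne') (Complex.exp_ne_zero _)
  exact (mul_eq_zero.1 ht).resolve_left this

/-! ### The Wigner type transform on square integrable functions -/

theorem map_sub_div_volume {b : ℝ} (hb : b ≠ 0) (x : ℝ) :
    Measure.map (fun k : ℝ => x - k / b) volume = ENNReal.ofReal |b| • volume := by
  have h1 : (fun k : ℝ => x - k / b) = (fun y => x - y) ∘ (fun k => b⁻¹ * k) := by
    funext k
    simp [div_eq_inv_mul]
  rw [h1, ← Measure.map_map (by fun_prop) (by fun_prop),
    Real.map_volume_mul_left (inv_ne_zero hb), Measure.map_smul, inv_inv,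
    (Measure.measurePreserving_sub_left volume x).map_eq]

theorem lintegral_comp_sub_div {b : ℝ} (hb : b ≠ 0) (x : ℝ) {f : ℝ → ℝ≥0∞} (hf : Measurable f) :
    ∫⁻ k, f (x - k / b) = ENNReal.ofReal |b| * ∫⁻ t, f t := by
  rw [← lintegral_map hf (by fun_prop), map_sub_div_volume hb, lintegral_smul_measure, smul_eq_mul]

theorem quasiMeasurePreserving_sub_div {b : ℝ} (hb : b ≠ 0) (x : ℝ) :
    Measure.QuasiMeasurePreserving (fun k : ℝ => x - k / b) volume volume :=
  ⟨by fun_prop, by rw [map_sub_div_volume hb]; exact Measure.smul_absolutelyContinuous⟩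

theorem memLp_comp_sub_div {b : ℝ} (hb : b ≠ 0) (x : ℝ) {φ : ℝ → ℂ} (hφ : MemLp φ 2) :
    MemLp (fun k => φ (x - k / b)) 2 := by
  have : MemLp φ 2 (Measure.map (fun k : ℝ => x - k / b) volume) := by
    rw [map_sub_div_volume hb]
    exact hφ.smul_measure ENNReal.ofReal_ne_top
  exact this.comp_of_map (by fun_prop)

theorem norm_exp_neg_I_mul (k y : ℝ) : ‖Complex.exp (-Complex.I * k * y)‖ = 1 := by
  rw [Complex.norm_exp]
  simp

theorem norm_wignerIntegrand (b : ℝ) (φ g : ℝ → ℂ) (x : ℝ × ℝ) (k : ℝ) :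
    ‖wignerIntegrand b φ g x k‖ = ‖φ (x.1 - k / b) * g k‖ := by
  rw [wignerIntegrand, mul_assoc, norm_mul, norm_exp_neg_I_mul, one_mul]

theorem integrable_comp_sub_div_mul {b : ℝ} (hb : b ≠ 0) {φ g : ℝ → ℂ} (hφ : MemLp φ 2)
    (hg : MemLp g 2) (x : ℝ) : Integrable fun k => φ (x - k / b) * g k :=
  (memLp_comp_sub_div hb x hφ).integrable_mul hg

theorem integrable_wignerIntegrand {b : ℝ} (hb : b ≠ 0) {φ g : ℝ → ℂ} (hφ : MemLp φ 2)
    (hg : MemLp g 2) (x : ℝ × ℝ) : Integrable (wignerIntegrand b φ g x) := by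
  have h := integrable_comp_sub_div_mul hb hφ hg x.1
  refine (integrable_norm_iff ?_).1 (h.norm.congr
    (Filter.Eventually.of_forall fun k => (norm_wignerIntegrand b φ g x k).symm))
  have := (by fun_prop : Continuous fun k : ℝ =>
    Complex.exp (-Complex.I * k * x.2)).aestronglyMeasurable.mul h.aestronglyMeasurable
    (μ := volume)
  refine this.congr (Filter.Eventually.of_forall fun k => ?_)
  simp only [wignerIntegrand, Pi.mul_apply, mul_assoc]

theorem wignerTransform_congr {b : ℝ} (hb : b ≠ 0) {φ φ' g g' : ℝ → ℂ} (hφ : φ =ᵐ[volume] φ')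
    (hg : g =ᵐ[volume] g') : wignerTransform b φ g = wignerTransform b φ' g' := by
  funext x
  unfold wignerTransform
  congr 1
  refine integral_congr_ae ?_
  filter_upwards [(quasiMeasurePreserving_sub_div hb x.1).ae_eq_comp hφ, hg] with k h1 h2
  simp only [Function.comp_apply] at h1
  simp only [wignerIntegrand, h1, h2]

theorem stronglyMeasurable_wignerTransform (b : ℝ) {φ g : ℝ → ℂ} (hφ : StronglyMeasurable φ)
    (hg : StronglyMeasurable g) : StronglyMeasurable (wignerTransform b φ g) := by
  refine StronglyMeasurable.const_mul (StronglyMeasurable.integral_prod_right (ν := volume) ?_) _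
  refine StronglyMeasurable.mul (StronglyMeasurable.mul ?_ ?_) ?_
  · exact Continuous.stronglyMeasurable (by fun_prop)
  · exact hφ.comp_measurable (by fun_prop)
  · exact hg.comp_measurable (by fun_prop)

/-- For fixed `x₁` the transform is a rescaled Fourier transform in `x₂`, which makes Plancherel
available slice by slice. -/
theorem wignerTransform_eq_fourier (b : ℝ) (φ g : ℝ → ℂ) (x : ℝ × ℝ) :
    wignerTransform b φ g x = ((1 / √(2 * Real.pi) : ℝ) : ℂ)
      * 𝓕 (fun k => φ (x.1 - k / b) * g k) (x.2 / (2 * Real.pi)) := by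
  rw [wignerTransform, Real.fourier_real_eq_integral_exp_smul]
  congr 1
  refine integral_congr_ae (Filter.Eventually.of_forall fun k => ?_)
  simp only [wignerIntegrand, smul_eq_mul, mul_assoc]
  congr 2
  have : (Real.pi : ℂ) ≠ 0 := by exact_mod_cast Real.pi_ne_zero
  push_cast
  field_simp

theorem enorm_sq_inv_sqrt_two_pi :
    ‖((1 / √(2 * Real.pi) : ℝ) : ℂ)‖ₑ ^ 2 * ENNReal.ofReal (2 * Real.pi) = 1 := by
  have h : (0 : ℝ) < 2 * Real.pi := by positivity
  rw [← ofReal_norm, ← ENNReal.ofReal_pow (norm_nonneg _), ← ENNReal.ofReal_mul (by positivity),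
    Complex.norm_real, Real.norm_of_nonneg (by positivity), div_pow, Real.sq_sqrt h.le]
  rw [one_pow, one_div, inv_mul_cancel₀ h.ne', ENNReal.ofReal_one]

theorem lintegral_enorm_sq_wignerTransform_slice {b : ℝ} (hb : b ≠ 0) {φ g : ℝ → ℂ}
    (hφ : MemLp φ 2) (hg : MemLp g 2) (x : ℝ) (h : MemLp (fun k => φ (x - k / b) * g k) 2) :
    ∫⁻ y, ‖wignerTransform b φ g (x, y)‖ₑ ^ 2 = ∫⁻ k, ‖φ (x - k / b)‖ₑ ^ 2 * ‖g k‖ₑ ^ 2 := by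
  have hi := integrable_comp_sub_div_mul hb hφ hg x
  have hc : Continuous (𝓕 (fun k => φ (x - k / b) * g k)) :=
    VectorFourier.fourierIntegral_continuous Real.continuous_fourierChar
      (by exact continuous_inner) hi
  have hpi : -(2 * Real.pi) ≠ 0 := by
    have := Real.pi_pos
    linarith
  -- With centre `0` and parameter `-(2π)` the substitution is `y ↦ y / (2π)`; its Jacobian cancels
  -- the squared prefactor of the transform.
  have hs := lintegral_comp_sub_div hpi 0
    (f := fun y => ‖𝓕 (fun k => φ (x - k / b) * g k) y‖ₑ ^ 2)
    (hc.measurable.enorm.pow_const 2)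
  rw [lintegral_enorm_sq_fourier hi h, abs_neg, abs_of_pos (by positivity)] at hs
  simp only [zero_sub, div_neg, neg_neg, enorm_mul, mul_pow] at hs
  simp only [wignerTransform_eq_fourier, enorm_mul, mul_pow]
  rw [lintegral_const_mul' _ _ (ENNReal.pow_ne_top enorm_ne_top), hs, ← mul_assoc, enorm_sq_inv_sqrt_two_pi, one_mul]

theorem lintegral_enorm_sq_lt_top {φ : ℝ → ℂ} (hφ : MemLp φ 2) : ∫⁻ t, ‖φ t‖ₑ ^ 2 < ⊤ := by
  simpa using lintegral_rpow_enorm_lt_top_of_eLpNorm_lt_top (p := 2) (by norm_num) (by norm_num)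
    hφ.eLpNorm_lt_top

theorem lintegral_lintegral_sub_div_mul (b : ℝ) {φ g : ℝ → ℝ≥0∞} (hφ : Measurable φ)
    (hg : Measurable g) :
    ∫⁻ x, ∫⁻ k, φ (x - k / b) * g k = (∫⁻ t, φ t) * ∫⁻ k, g k := by
  rw [lintegral_lintegral_swap (by
    refine (Measurable.mul ?_ ?_).aemeasurable
    · exact hφ.comp (by fun_prop)
    · exact hg.comp measurable_snd)]
  rw [← lintegral_const_mul _ hg]
  refine lintegral_congr fun k => ?_
  have hm : Measurable fun x => φ (x - k / b) := hφ.comp (by fun_prop)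
  rw [lintegral_mul_const _ hm,
    lintegral_sub_right_eq_self (fun x => φ x) (k / b)]

/-- The Wigner type transform multiplies norms. -/
theorem lintegral_enorm_sq_wignerTransform {b : ℝ} (hb : b ≠ 0) {φ g : ℝ → ℂ}
    (hφ : MemLp φ 2) (hg : MemLp g 2) :
    ∫⁻ x, ‖wignerTransform b φ g x‖ₑ ^ 2 = (∫⁻ t, ‖φ t‖ₑ ^ 2) * ∫⁻ k, ‖g k‖ₑ ^ 2 := by
  -- Tonelli needs measurable representatives; the transform depends only on the almost everywhere
  -- classes.
  wlog hm : StronglyMeasurable φ ∧ StronglyMeasurable g generalizing φ g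
  · have e1 := hφ.1.ae_eq_mk
    have e2 := hg.1.ae_eq_mk
    have := this ((memLp_congr_ae e1).1 hφ) ((memLp_congr_ae e2).1 hg)
      ⟨hφ.1.stronglyMeasurable_mk, hg.1.stronglyMeasurable_mk⟩
    rw [wignerTransform_congr hb e1 e2, this]
    congr 1
    · exact lintegral_congr_ae (by filter_upwards [e1] with t ht; rw [ht])
    · exact lintegral_congr_ae (by filter_upwards [e2] with t ht; rw [ht])
  obtain ⟨mφ, mg⟩ := hm
  have hmφ : Measurable fun t => ‖φ t‖ₑ ^ 2 := mφ.measurable.enorm.pow_const 2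
  have hmg : Measurable fun t => ‖g t‖ₑ ^ 2 := mg.measurable.enorm.pow_const 2
  have htot := lintegral_lintegral_sub_div_mul b hmφ hmg
  have hfin : ∫⁻ x, ∫⁻ k, ‖φ (x - k / b)‖ₑ ^ 2 * ‖g k‖ₑ ^ 2 ≠ ⊤ := by
    rw [htot]
    exact (ENNReal.mul_lt_top (lintegral_enorm_sq_lt_top hφ) (lintegral_enorm_sq_lt_top hg)).ne
  rw [Measure.volume_eq_prod, lintegral_prod _
    ((stronglyMeasurable_wignerTransform b mφ mg).measurable.enorm.pow_const 2).aemeasurable, ← htot]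
  have hmeas : Measurable fun x => ∫⁻ k, ‖φ (x - k / b)‖ₑ ^ 2 * ‖g k‖ₑ ^ 2 := by
    refine Measurable.lintegral_prod_right' (f := fun p : ℝ × ℝ =>
      ‖φ (p.1 - p.2 / b)‖ₑ ^ 2 * ‖g p.2‖ₑ ^ 2) ?_
    exact (hmφ.comp (by fun_prop : Measurable fun p : ℝ × ℝ => p.1 - p.2 / b)).mul
      (hmg.comp measurable_snd)
  refine lintegral_congr_ae ?_
  -- The slice product is square integrable only for almost every `x₁`, as the double integral is
  -- finite; elsewhere Plancherel is not applied.
  filter_upwards [ae_lt_top hmeas hfin] with x hx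
  refine lintegral_enorm_sq_wignerTransform_slice hb hφ hg x ⟨?_, ?_⟩
  · exact (integrable_comp_sub_div_mul hb hφ hg x).1
  · rw [eLpNorm_lt_top_iff_lintegral_rpow_enorm_lt_top (by norm_num) (by norm_num)]
    simpa [mul_pow] using hx

theorem memLp_wignerTransform {b : ℝ} (hb : b ≠ 0) {φ g : ℝ → ℂ} (hφ : MemLp φ 2)
    (hg : MemLp g 2) : MemLp (wignerTransform b φ g) 2 := by
  refine ⟨?_, ?_⟩
  · rw [wignerTransform_congr hb hφ.1.ae_eq_mk hg.1.ae_eq_mk]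
    exact (stronglyMeasurable_wignerTransform b hφ.1.stronglyMeasurable_mk
      hg.1.stronglyMeasurable_mk).aestronglyMeasurable
  · rw [eLpNorm_lt_top_iff_lintegral_rpow_enorm_lt_top (by norm_num) (by norm_num)]
    have := ENNReal.mul_lt_top (lintegral_enorm_sq_lt_top hφ) (lintegral_enorm_sq_lt_top hg)
    rw [← lintegral_enorm_sq_wignerTransform hb hφ hg] at this
    simpa using this

theorem wignerTransform_add_left {b : ℝ} (hb : b ≠ 0) {φ φ' g : ℝ → ℂ} (hφ : MemLp φ 2)
    (hφ' : MemLp φ' 2) (hg : MemLp g 2) :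
    wignerTransform b (φ + φ') g = wignerTransform b φ g + wignerTransform b φ' g := by
  funext x
  rw [Pi.add_apply, wignerTransform, wignerTransform, wignerTransform, ← mul_add,
    ← integral_add (integrable_wignerIntegrand hb hφ hg x) (integrable_wignerIntegrand hb hφ' hg x)]
  congr 2
  funext k
  simp only [wignerIntegrand, Pi.add_apply]
  ring

theorem wignerTransform_add_right {b : ℝ} (hb : b ≠ 0) {φ g g' : ℝ → ℂ} (hφ : MemLp φ 2)
    (hg : MemLp g 2) (hg' : MemLp g' 2) :
    wignerTransform b φ (g + g') = wignerTransform b φ g + wignerTransform b φ g' := by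
  funext x
  rw [Pi.add_apply, wignerTransform, wignerTransform, wignerTransform, ← mul_add,
    ← integral_add (integrable_wignerIntegrand hb hφ hg x) (integrable_wignerIntegrand hb hφ hg' x)]
  congr 2
  funext k
  simp only [wignerIntegrand, Pi.add_apply]
  ring

theorem wignerTransform_smul_left (b : ℝ) (c : ℂ) (φ g : ℝ → ℂ) :
    wignerTransform b (c • φ) g = c • wignerTransform b φ g := by
  funext x
  rw [Pi.smul_apply, wignerTransform, wignerTransform, smul_eq_mul, mul_left_comm c,
    ← integral_const_mul c]
  congr 2
  funext k
  simp only [wignerIntegrand, Pi.smul_apply, smul_eq_mul]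
  ring

theorem wignerTransform_smul_right (b : ℝ) (c : ℂ) (φ g : ℝ → ℂ) :
    wignerTransform b φ (c • g) = c • wignerTransform b φ g := by
  funext x
  rw [Pi.smul_apply, wignerTransform, wignerTransform, smul_eq_mul, mul_left_comm c,
    ← integral_const_mul c]
  congr 2
  funext k
  simp only [wignerIntegrand, Pi.smul_apply, smul_eq_mul]
  ring

/-- The Wigner type transform as a bilinear map on `L²(ℝ)`. -/
def wignerLinear {b : ℝ} (hb : b ≠ 0) : L2Line →ₗ[ℂ] L2Line →ₗ[ℂ] L2Plane :=
  LinearMap.mk₂ ℂ (fun φ g => (memLp_wignerTransform hb (Lp.memLp φ) (Lp.memLp g)).toLp _)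
    (by
      intro φ φ' g
      rw [← MemLp.toLp_add]
      refine MemLp.toLp_congr _ _ (Filter.EventuallyEq.of_eq ?_)
      rw [wignerTransform_congr hb (Lp.coeFn_add φ φ') (ae_eq_refl _),
        wignerTransform_add_left hb (Lp.memLp φ) (Lp.memLp φ') (Lp.memLp g)])
    (by
      intro c φ g
      rw [← MemLp.toLp_const_smul]
      refine MemLp.toLp_congr _ _ (Filter.EventuallyEq.of_eq ?_)
      rw [wignerTransform_congr hb (Lp.coeFn_smul c φ) (ae_eq_refl _), wignerTransform_smul_left])
    (by
      intro φ g g'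
      rw [← MemLp.toLp_add]
      refine MemLp.toLp_congr _ _ (Filter.EventuallyEq.of_eq ?_)
      rw [wignerTransform_congr hb (ae_eq_refl _) (Lp.coeFn_add g g'),
        wignerTransform_add_right hb (Lp.memLp φ) (Lp.memLp g) (Lp.memLp g')])
    (by
      intro c φ g
      rw [← MemLp.toLp_const_smul]
      refine MemLp.toLp_congr _ _ (Filter.EventuallyEq.of_eq ?_)
      rw [wignerTransform_congr hb (ae_eq_refl _) (Lp.coeFn_smul c g), wignerTransform_smul_right])

theorem coeFn_wignerLinear {b : ℝ} (hb : b ≠ 0) (φ g : L2Line) :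
    wignerLinear hb φ g =ᵐ[volume] wignerTransform b φ g :=
  (memLp_wignerTransform hb (Lp.memLp φ) (Lp.memLp g)).coeFn_toLp

theorem enorm_sq_eq_lintegral {α : Type*} [MeasurableSpace α] {μ : Measure α} (f : Lp ℂ 2 μ) :
    ‖f‖ₑ ^ 2 = ∫⁻ x, ‖f x‖ₑ ^ 2 ∂μ := by
  have h := eLpNorm_eq_lintegral_rpow_enorm_toReal (p := 2) (by norm_num) (by norm_num)
    (f := (f : α → ℂ)) (μ := μ)
  rw [Lp.enorm_def, h, ← ENNReal.rpow_natCast, ← ENNReal.rpow_mul]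
  simp

theorem norm_wignerLinear {b : ℝ} (hb : b ≠ 0) (φ g : L2Line) :
    ‖wignerLinear hb φ g‖ = ‖φ‖ * ‖g‖ := by
  have h : ‖wignerLinear hb φ g‖ₑ ^ 2 = (‖φ‖ₑ * ‖g‖ₑ) ^ 2 := by
    rw [mul_pow, enorm_sq_eq_lintegral, enorm_sq_eq_lintegral, enorm_sq_eq_lintegral,
      ← lintegral_enorm_sq_wignerTransform hb (Lp.memLp φ) (Lp.memLp g)]
    refine lintegral_congr_ae ?_
    filter_upwards [coeFn_wignerLinear hb φ g] with x hx
    rw [hx]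
  have h2 := ENNReal.pow_right_strictMono (n := 2) (by norm_num) |>.injective h
  rw [← toReal_enorm, h2, ENNReal.toReal_mul, toReal_enorm, toReal_enorm]

/-- The Wigner type transform as a bounded bilinear map on `L²(ℝ)`. -/
def wignerCLM {b : ℝ} (hb : b ≠ 0) : L2Line →L[ℂ] L2Line →L[ℂ] L2Plane :=
  (wignerLinear hb).mkContinuous₂ 1 fun φ g => by rw [norm_wignerLinear, one_mul]

theorem coeFn_wignerCLM {b : ℝ} (hb : b ≠ 0) (φ g : L2Line) :
    wignerCLM hb φ g =ᵐ[volume] wignerTransform b φ g := coeFn_wignerLinear hb φ g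

theorem norm_wignerCLM {b : ℝ} (hb : b ≠ 0) (φ g : L2Line) :
    ‖wignerCLM hb φ g‖ = ‖φ‖ * ‖g‖ := norm_wignerLinear hb φ g

theorem wignerCLM_toLp {b : ℝ} (hb : b ≠ 0) {φ g : ℝ → ℂ} (hφ : MemLp φ 2) (hg : MemLp g 2) :
    wignerCLM hb (hφ.toLp φ) (hg.toLp g) = (memLp_wignerTransform hb hφ hg).toLp _ := by
  refine Lp.ext ?_
  refine (coeFn_wignerCLM hb _ _).trans ?_
  rw [wignerTransform_congr hb hφ.coeFn_toLp hg.coeFn_toLp]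
  exact (MemLp.coeFn_toLp _).symm

/-! ### Duality with Schwartz functions of the plane -/

/-- The complex conjugate of a Schwartz function. -/
def conjSchwartz (u : 𝓢(ℝ × ℝ, ℂ)) : 𝓢(ℝ × ℝ, ℂ) :=
  postcompCLM (𝕜 := ℝ) (Complex.conjCLE : ℂ →L[ℝ] ℂ) u

theorem conjSchwartz_apply (u : 𝓢(ℝ × ℝ, ℂ)) (x : ℝ × ℝ) :
    conjSchwartz u x = starRingEnd ℂ (u x) := rfl

theorem lineDerivOp_conjSchwartz (u : 𝓢(ℝ × ℝ, ℂ)) (v x : ℝ × ℝ) :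
    (∂_{v} (conjSchwartz u) : 𝓢(ℝ × ℝ, ℂ)) x
      = starRingEnd ℂ ((∂_{v} u : 𝓢(ℝ × ℝ, ℂ)) x) := by
  have h : HasFDerivAt (fun x => starRingEnd ℂ (u x))
      ((Complex.conjCLE : ℂ →L[ℝ] ℂ).comp (fderiv ℝ u x)) x :=
    (Complex.conjCLE : ℂ →L[ℝ] ℂ).hasFDerivAt.comp x (u.hasFDerivAt x)
  have e : (conjSchwartz u : ℝ × ℝ → ℂ) = fun x => starRingEnd ℂ (u x) := rfl
  rw [lineDerivOp_apply_eq_fderiv, lineDerivOp_apply_eq_fderiv, e, h.fderiv]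
  rfl

/-- The generalized eigenfunctions `exp (-i k x₂) φ(x₁ - k / b)`. -/
def planeWave (b : ℝ) (φ : ℝ → ℂ) (k : ℝ) (x : ℝ × ℝ) : ℂ :=
  Complex.exp (-Complex.I * k * x.2) * φ (x.1 - k / b)

theorem hasLineDerivAt_planeWave_one (b : ℝ) (φ : 𝓢(ℝ, ℂ)) (k : ℝ) (x : ℝ × ℝ) :
    HasLineDerivAt ℝ (planeWave b φ k) (planeWave b (derivCLM ℂ ℂ φ) k x) x (1, 0) := by
  have h1 : HasDerivAt (fun t : ℝ => x.1 + t - k / b) 1 0 :=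
    ((hasDerivAt_id (0 : ℝ)).const_add x.1).sub_const _
  have h2 : HasDerivAt (fun t : ℝ => φ (x.1 + t - k / b)) (deriv φ (x.1 - k / b)) 0 := by
    have h : HasDerivAt φ (deriv φ (x.1 - k / b)) (x.1 + 0 - k / b) := by
      rw [add_zero]
      exact φ.hasDerivAt _
    simpa [Function.comp_def] using HasDerivAt.scomp (0 : ℝ) h h1
  have h3 := h2.const_mul (Complex.exp (-Complex.I * k * x.2))
  simpa [HasLineDerivAt, planeWave] using h3

theorem hasLineDerivAt_planeWave_two (b : ℝ) (φ : ℝ → ℂ) (k : ℝ) (x : ℝ × ℝ) :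
    HasLineDerivAt ℝ (planeWave b φ k) (-Complex.I * k * planeWave b φ k x) x (0, 1) := by
  have h0 : HasDerivAt (fun t : ℝ => (x.2 : ℂ) + (t : ℂ)) 1 0 :=
    (Complex.ofRealCLM.hasDerivAt (x := (0 : ℝ))).const_add _
  have h1 : HasDerivAt (fun t : ℝ => -Complex.I * k * ((x.2 : ℂ) + (t : ℂ)))
      (-Complex.I * k * 1) 0 := h0.const_mul _
  have h2 := h1.cexp.mul_const (φ (x.1 - k / b))
  have h3 : HasDerivAt (fun t : ℝ => Complex.exp (-Complex.I * k * ((x.2 : ℂ) + (t : ℂ)))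
      * φ (x.1 - k / b)) (-Complex.I * k * planeWave b φ k x) 0 := by
    refine h2.congr_deriv ?_
    simp [planeWave]
    ring
  simpa [HasLineDerivAt, planeWave] using h3

theorem continuous_planeWave (b : ℝ) (φ : 𝓢(ℝ, ℂ)) (k : ℝ) : Continuous (planeWave b φ k) := by
  unfold planeWave
  have := φ.continuous
  fun_prop

theorem norm_planeWave_le (b : ℝ) (φ : 𝓢(ℝ, ℂ)) (k : ℝ) (x : ℝ × ℝ) :
    ‖planeWave b φ k x‖ ≤ SchwartzMap.seminorm ℂ 0 0 φ := by
  rw [planeWave, norm_mul, norm_exp_neg_I_mul, one_mul]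
  exact norm_le_seminorm ℂ φ _

theorem integrable_mul_planeWave (b : ℝ) (v : 𝓢(ℝ × ℝ, ℂ)) (φ : 𝓢(ℝ, ℂ)) (k : ℝ) :
    Integrable fun x => v x * planeWave b φ k x :=
  v.integrable.mul_bdd (c := SchwartzMap.seminorm ℂ 0 0 φ) (continuous_planeWave b φ k).aestronglyMeasurable
    (Filter.Eventually.of_forall (norm_planeWave_le b φ k))

theorem integral_lineDerivOp_one_mul_planeWave (b : ℝ) (v : 𝓢(ℝ × ℝ, ℂ)) (φ : 𝓢(ℝ, ℂ)) (k : ℝ) :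
    ∫ x, (∂_{((1, 0) : ℝ × ℝ)} v : 𝓢(ℝ × ℝ, ℂ)) x * planeWave b φ k x
      = -∫ x, v x * planeWave b (derivCLM ℂ ℂ φ) k x := by
  have := integral_bilinear_hasLineDerivAt_right_eq_neg_left_of_integrable
    (μ := (volume : Measure (ℝ × ℝ))) (B := ContinuousLinearMap.mul ℝ ℂ) (v := ((1, 0) : ℝ × ℝ))
    (integrable_mul_planeWave b (∂_{((1, 0) : ℝ × ℝ)} v) φ k)
    (integrable_mul_planeWave b v (derivCLM ℂ ℂ φ) k)
    (integrable_mul_planeWave b v φ k)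
    (fun x _ => (v.hasFDerivAt x).hasLineDerivAt _)
    (fun x _ => hasLineDerivAt_planeWave_one b φ k x)
  simp only [ContinuousLinearMap.mul_apply'] at this
  rw [this, neg_neg]

theorem integral_lineDerivOp_two_mul_planeWave (b : ℝ) (v : 𝓢(ℝ × ℝ, ℂ)) (φ : 𝓢(ℝ, ℂ)) (k : ℝ) :
    ∫ x, (∂_{((0, 1) : ℝ × ℝ)} v : 𝓢(ℝ × ℝ, ℂ)) x * planeWave b φ k x
      = Complex.I * k * ∫ x, v x * planeWave b φ k x := by
  have := integral_bilinear_hasLineDerivAt_right_eq_neg_left_of_integrable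
    (μ := (volume : Measure (ℝ × ℝ))) (B := ContinuousLinearMap.mul ℝ ℂ) (v := ((0, 1) : ℝ × ℝ))
    (integrable_mul_planeWave b (∂_{((0, 1) : ℝ × ℝ)} v) φ k)
    (g' := fun x => -Complex.I * k * planeWave b φ k x)
    (by
      refine ((integrable_mul_planeWave b v φ k).const_mul (-Complex.I * k)).congr
        (Filter.Eventually.of_forall fun x => ?_)
      simp only [ContinuousLinearMap.mul_apply']
      ring)
    (integrable_mul_planeWave b v φ k)
    (fun x _ => (v.hasFDerivAt x).hasLineDerivAt _)
    (fun x _ => hasLineDerivAt_planeWave_two b φ k x)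
  simp only [ContinuousLinearMap.mul_apply', mul_left_comm _ (-Complex.I * (k : ℂ)),
    integral_const_mul] at this
  rw [← neg_eq_iff_eq_neg] at this
  refine Eq.trans this.symm ?_
  ring

theorem integral_comp_sub_div {E : Type*} [NormedAddCommGroup E] [NormedSpace ℝ E] {b : ℝ}
    (hb : b ≠ 0) (x : ℝ) {f : ℝ → E} (hf : Continuous f) :
    ∫ k, f (x - k / b) = |b| • ∫ t, f t := by
  rw [← integral_map (φ := fun k => x - k / b) (by fun_prop) hf.aestronglyMeasurable,
    map_sub_div_volume hb, integral_smul_measure, ENNReal.toReal_ofReal (abs_nonneg b)]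

/-- This justifies Fubini. The `k`-integral of `|φ(x₁ - k / b) g(k)|` is bounded uniformly in `x` by
`|b| ‖φ‖² + ‖g‖²`, so integrability of `v` suffices. -/
theorem integrable_schwartz_mul_wignerIntegrand {b : ℝ} (hb : b ≠ 0) (v : 𝓢(ℝ × ℝ, ℂ))
    (φ : 𝓢(ℝ, ℂ)) (g : L2Line) :
    Integrable (fun p : (ℝ × ℝ) × ℝ => v p.1 * wignerIntegrand b φ g p.1 p.2)
      ((volume : Measure (ℝ × ℝ)).prod (volume : Measure ℝ)) := by
  have hφ := φ.memLp 2 (volume : Measure ℝ)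
  have hφc := φ.continuous
  have hm : AEStronglyMeasurable (fun p : (ℝ × ℝ) × ℝ => v p.1 * wignerIntegrand b φ g p.1 p.2)
      ((volume : Measure (ℝ × ℝ)).prod (volume : Measure ℝ)) := by
    have hv := v.continuous
    have h1 : Continuous fun p : (ℝ × ℝ) × ℝ => v p.1
        * (Complex.exp (-Complex.I * p.2 * p.1.2) * φ (p.1.1 - p.2 / b)) := by fun_prop
    have h2 := h1.stronglyMeasurable.mul
      ((Lp.stronglyMeasurable g).comp_measurable (measurable_snd (α := ℝ × ℝ)))
    refine h2.aestronglyMeasurable.congr (Filter.Eventually.of_forall fun p => ?_)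
    simp only [wignerIntegrand, Pi.mul_apply, Function.comp_apply]
    ring
  rw [integrable_prod_iff hm]
  refine ⟨Filter.Eventually.of_forall fun x =>
    (integrable_wignerIntegrand hb hφ (Lp.memLp g) x).const_mul (v x), ?_⟩
  have iφ : Integrable fun t => ‖φ t‖ ^ 2 :=
    (memLp_two_iff_integrable_sq_norm hφ.1).1 hφ
  have ig : Integrable fun t => ‖g t‖ ^ 2 :=
    (memLp_two_iff_integrable_sq_norm (Lp.memLp g).1).1 (Lp.memLp g)
  refine (v.integrable.norm.mul_const (|b| * (∫ t, ‖φ t‖ ^ 2) + ∫ t, ‖g t‖ ^ 2)).mono'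
    hm.norm.integral_prod_right' (Filter.Eventually.of_forall fun x => ?_)
  rw [Real.norm_of_nonneg (integral_nonneg fun _ => norm_nonneg _)]
  simp only [norm_mul, norm_wignerIntegrand]
  rw [integral_const_mul]
  refine mul_le_mul_of_nonneg_left ?_ (norm_nonneg _)
  have is : Integrable fun k => ‖φ (x.1 - k / b)‖ ^ 2 :=
    (memLp_two_iff_integrable_sq_norm (memLp_comp_sub_div hb x.1 hφ).1).1
      (memLp_comp_sub_div hb x.1 hφ)
  have hs : ∫ k, ‖φ (x.1 - k / b)‖ ^ 2 = |b| * ∫ t, ‖φ t‖ ^ 2 :=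
    integral_comp_sub_div hb x.1 (f := fun t => ‖φ t‖ ^ 2) (by fun_prop)
  rw [← hs, ← integral_add is ig]
  refine integral_mono_of_nonneg (Filter.Eventually.of_forall fun k => by positivity) (is.add ig)
    (Filter.Eventually.of_forall fun k => ?_)
  simp only
  nlinarith [sq_nonneg (‖φ (x.1 - k / b)‖ - ‖g k‖), sq_nonneg (‖φ (x.1 - k / b)‖),
    sq_nonneg (‖g k‖)]

/-- The inner product of a Schwartz function with a transform, as an integral over `k`. -/
theorem inner_toLp_wignerCLM {b : ℝ} (hb : b ≠ 0) (u : 𝓢(ℝ × ℝ, ℂ)) (φ : 𝓢(ℝ, ℂ)) (g : L2Line) :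
    ⟪u.toLp 2 volume, wignerCLM hb (φ.toLp 2) g⟫_ℂ = ((1 / √(2 * Real.pi) : ℝ) : ℂ)
      * ∫ k, g k * ∫ x, conjSchwartz u x * planeWave b φ k x := by
  have e1 : ⟪u.toLp 2 volume, wignerCLM hb (φ.toLp 2) g⟫_ℂ
      = ∫ x, ((1 / √(2 * Real.pi) : ℝ) : ℂ)
        * ∫ k, conjSchwartz u x * wignerIntegrand b φ g x k := by
    rw [L2.inner_def]
    refine integral_congr_ae ?_
    filter_upwards [u.coeFn_toLp 2 volume, coeFn_wignerCLM hb (φ.toLp 2) g] with x h1 h2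
    rw [h1, h2, wignerTransform_congr hb (φ.coeFn_toLp 2 volume) (ae_eq_refl _), RCLike.inner_apply,
      wignerTransform, integral_const_mul, conjSchwartz_apply]
    ring
  rw [e1, integral_const_mul, integral_integral_swap
    (integrable_schwartz_mul_wignerIntegrand hb (conjSchwartz u) φ g)]
  congr 1
  refine integral_congr_ae (Filter.Eventually.of_forall fun k => ?_)
  simp only
  rw [← integral_const_mul]
  refine integral_congr_ae (Filter.Eventually.of_forall fun x => ?_)
  simp only [wignerIntegrand, planeWave]
  ring

theorem inner_lineDerivOp_one_wignerCLM {b : ℝ} (hb : b ≠ 0) (u : 𝓢(ℝ × ℝ, ℂ)) (φ : 𝓢(ℝ, ℂ))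
    (g : L2Line) :
    ⟪(∂_{((1, 0) : ℝ × ℝ)} u : 𝓢(ℝ × ℝ, ℂ)).toLp 2 volume, wignerCLM hb (φ.toLp 2) g⟫_ℂ
      = -⟪u.toLp 2 volume, wignerCLM hb ((derivCLM ℂ ℂ φ).toLp 2) g⟫_ℂ := by
  rw [inner_toLp_wignerCLM, inner_toLp_wignerCLM, ← mul_neg, ← integral_neg]
  congr 2
  funext k
  rw [← mul_neg, ← integral_lineDerivOp_one_mul_planeWave]
  congr 2
  funext x
  rw [lineDerivOp_conjSchwartz, conjSchwartz_apply]

/-- On each plane wave `-i ∂₂ + b x₁` becomes `b (x₁ - k / b)`. The relation is stated weakly, since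
`𝒲(φ, g)` need not be differentiable in `x₂` for general `g`. -/
theorem inner_momentumTwo_wignerCLM {b : ℝ} (hb : b ≠ 0) (u : 𝓢(ℝ × ℝ, ℂ)) (φ : 𝓢(ℝ, ℂ))
    (g : L2Line) :
    ⟪(momentumTwo b u).toLp 2 volume, wignerCLM hb (φ.toLp 2) g⟫_ℂ
      = (b : ℂ) * ⟪u.toLp 2 volume, wignerCLM hb ((positionCLM φ).toLp 2) g⟫_ℂ := by
  rw [inner_toLp_wignerCLM, inner_toLp_wignerCLM, mul_left_comm (b : ℂ),
    ← integral_const_mul (b : ℂ)]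
  congr 2
  funext k
  rw [mul_left_comm (b : ℂ)]
  congr 1
  have hbC : (b : ℂ) ≠ 0 := by exact_mod_cast hb
  -- Split `b x₁ = k + b (x₁ - k / b)`; after integration by parts the `∂₂` term cancels the `k`
  -- term.
  have e : ∀ x, conjSchwartz (momentumTwo b u) x * planeWave b φ k x
      = Complex.I * ((∂_{((0, 1) : ℝ × ℝ)} (conjSchwartz u) : 𝓢(ℝ × ℝ, ℂ)) x * planeWave b φ k x)
        + ((k : ℂ) * (conjSchwartz u x * planeWave b φ k x)
          + (b : ℂ) * (conjSchwartz u x * planeWave b (positionCLM φ) k x)) := by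
    intro x
    rw [conjSchwartz_apply, momentumTwo_apply, ← SchwartzMap.lineDerivOp_apply,
      lineDerivOp_conjSchwartz]
    simp only [map_add, map_mul, map_neg, Complex.conj_I, Complex.conj_ofReal, planeWave,
      positionCLM_apply, conjSchwartz_apply]
    push_cast
    field_simp
    ring
  have i1 := (integrable_mul_planeWave b (∂_{((0, 1) : ℝ × ℝ)} (conjSchwartz u)) φ k).const_mul
    Complex.I
  have i2 := (integrable_mul_planeWave b (conjSchwartz u) φ k).const_mul (k : ℂ)
  have i3 := (integrable_mul_planeWave b (conjSchwartz u) (positionCLM φ) k).const_mul (b : ℂ)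
  have i4 : Integrable fun x => (k : ℂ) * (conjSchwartz u x * planeWave b φ k x)
      + (b : ℂ) * (conjSchwartz u x * planeWave b (positionCLM φ) k x) := i2.add i3
  simp only [e]
  rw [integral_add i1 i4, integral_add i2 i3,
    integral_const_mul, integral_const_mul, integral_const_mul,
    integral_lineDerivOp_two_mul_planeWave]
  linear_combination (k * ∫ x, conjSchwartz u x * planeWave b φ k x) * Complex.I_mul_I

theorem toLp_add_apply {E : Type*} [NormedAddCommGroup E] [NormedSpace ℝ E] [MeasurableSpace E]
    [BorelSpace E] [SecondCountableTopology E] {μ : Measure E} [μ.HasTemperateGrowth]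
    (f g : 𝓢(E, ℂ)) : (f + g).toLp 2 μ = f.toLp 2 μ + g.toLp 2 μ :=
  (toLpCLM ℂ ℂ 2 μ).map_add f g

theorem toLp_smul_apply {E : Type*} [NormedAddCommGroup E] [NormedSpace ℝ E] [MeasurableSpace E]
    [BorelSpace E] [SecondCountableTopology E] {μ : Measure E} [μ.HasTemperateGrowth]
    (c : ℂ) (f : 𝓢(E, ℂ)) : (c • f).toLp 2 μ = c • f.toLp 2 μ :=
  (toLpCLM ℂ ℂ 2 μ).map_smul c f

theorem toLp_neg_apply {E : Type*} [NormedAddCommGroup E] [NormedSpace ℝ E] [MeasurableSpace E]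
    [BorelSpace E] [SecondCountableTopology E] {μ : Measure E} [μ.HasTemperateGrowth]
    (f : 𝓢(E, ℂ)) : (-f).toLp 2 μ = -f.toLp 2 μ :=
  (toLpCLM ℂ ℂ 2 μ).map_neg f

/-- The Hermite function as an element of `L²(ℝ)`. -/
def hermiteLp {b : ℝ} (hb : b ≠ 0) (n : ℕ) : L2Line := (hermiteSchwartz b hb n).toLp 2

/-- The Landau operator acts on `𝒲(φₙ, g)` as multiplication by the Landau level. -/
theorem inner_landauSchwartz_wignerCLM {b : ℝ} (hb : b ≠ 0) (u : 𝓢(ℝ × ℝ, ℂ)) (n : ℕ)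
    (g : L2Line) :
    ⟪(landauSchwartz b u).toLp 2 volume, wignerCLM hb (hermiteLp hb n) g⟫_ℂ
      = (landauLevel b n : ℂ) * ⟪u.toLp 2 volume, wignerCLM hb (hermiteLp hb n) g⟫_ℂ := by
  have e : landauSchwartz b u
      = -(∂_{((1, 0) : ℝ × ℝ)} (∂_{((1, 0) : ℝ × ℝ)} u : 𝓢(ℝ × ℝ, ℂ)) : 𝓢(ℝ × ℝ, ℂ))
        + momentumTwo b (momentumTwo b u) := rfl
  -- The oscillator equation is pushed through the linear functional `f ↦ ⟪u, 𝒲(f, g)⟫`, to be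
  -- matched with the weak relations applied twice.
  have h := congrArg (fun f : 𝓢(ℝ, ℂ) => ⟪u.toLp 2 volume, wignerCLM hb (f.toLp 2) g⟫_ℂ)
    (oscillator_hermiteSchwartz b hb n)
  simp only [toLp_add_apply, toLp_neg_apply, toLp_smul_apply, map_add, map_neg, map_smul,
    add_apply, neg_apply, smul_apply, inner_add_right, inner_neg_right, inner_smul_right] at h
  rw [e, hermiteLp, toLp_add_apply, toLp_neg_apply, inner_add_left, inner_neg_left,
    inner_lineDerivOp_one_wignerCLM, inner_lineDerivOp_one_wignerCLM, inner_momentumTwo_wignerCLM,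
    inner_momentumTwo_wignerCLM, ← h]
  push_cast
  ring

/-! ### Transforms of Gaussians -/

/-- The Gaussian `exp (-a t² / 2 + v t)` with complex drift `v`. -/
def driftGaussian (a : ℝ) (v : ℂ) (t : ℝ) : ℂ := Complex.exp (-(a / 2 : ℝ) * t ^ 2 + v * t)

theorem memLp_driftGaussian {a : ℝ} (ha : 0 < a) (v : ℂ) : MemLp (driftGaussian a v) 2 :=
  memLp_cexp_quadratic ha v

/-- The normalization constant of the transform of Gaussians. -/
def gaussianTransformCoeff (b : ℝ) : ℂ :=
  ((1 / √(2 * Real.pi) : ℝ) : ℂ) * (Real.pi / ((|b|⁻¹ : ℝ) : ℂ)) ^ (1 / 2 : ℂ)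

theorem gaussianTransformCoeff_ne_zero {b : ℝ} (hb : b ≠ 0) : gaussianTransformCoeff b ≠ 0 := by
  have h1 : (1 / √(2 * Real.pi) : ℝ) ≠ 0 := by positivity
  refine mul_ne_zero (by exact_mod_cast h1) ?_
  rw [Ne, Complex.cpow_eq_zero_iff, not_and_or]
  left
  have : (Real.pi / |b|⁻¹ : ℝ) ≠ 0 := by positivity
  exact_mod_cast this

/-- The widths `|b|` and `|b|⁻¹` are matched so that both factors contribute `-k² / (2 |b|)`; the
rest is the Gaussian integral in `k`. The drifts enter the exponent linearly in `x`, which produces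
characters of the plane. -/
theorem wignerTransform_driftGaussian {b : ℝ} (hb : b ≠ 0) (v w : ℂ) (x : ℝ × ℝ) :
    wignerTransform b (driftGaussian |b| v) (driftGaussian |b|⁻¹ w) x
      = gaussianTransformCoeff b * Complex.exp (-((|b| : ℝ) / 2 : ℂ) * x.1 ^ 2 + v * x.1
        + (|b| : ℝ) / 4 * ((|b| : ℝ) / b * x.1 - Complex.I * x.2 + w - v / b) ^ 2) := by
  have hb' : |b| ≠ 0 := abs_ne_zero.2 hb
  have hbC : (b : ℂ) ≠ 0 := by exact_mod_cast hb
  have hbC' : ((|b| : ℝ) : ℂ) ≠ 0 := by exact_mod_cast hb'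
  have hsq : ((|b| : ℝ) : ℂ) * ((|b| : ℝ) : ℂ) = b * b := by
    rw [← Complex.ofReal_mul, abs_mul_abs_self, Complex.ofReal_mul]
  have e : ∀ k : ℝ, wignerIntegrand b (driftGaussian |b| v) (driftGaussian |b|⁻¹ w) x k
      = Complex.exp (-((|b|⁻¹ : ℝ) : ℂ) * k ^ 2
        + ((|b| : ℝ) / b * x.1 - Complex.I * x.2 + w - v / b) * k
        + (-((|b| : ℝ) / 2 : ℂ) * x.1 ^ 2 + v * x.1)) := by
    intro k
    rw [wignerIntegrand, driftGaussian, driftGaussian, ← Complex.exp_add, ← Complex.exp_add]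
    congr 1
    push_cast
    field_simp
    linear_combination (-(k : ℂ) ^ 2) * hsq
  have hneg : (-((|b|⁻¹ : ℝ) : ℂ)).re < 0 := by
    rw [Complex.neg_re, Complex.ofReal_re, neg_lt_zero]
    positivity
  rw [wignerTransform, gaussianTransformCoeff, mul_assoc]
  simp only [e]
  rw [integral_cexp_quadratic hneg, neg_neg]
  congr 3
  push_cast
  field_simp
  ring

theorem hasTemperateGrowth_cexp_I_mul :
    Function.HasTemperateGrowth (fun t : ℝ => Complex.exp (Complex.I * t)) := by
  have hd : ∀ n : ℕ, iteratedDeriv n (fun t : ℝ => Complex.exp (Complex.I * t))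
      = fun t : ℝ => Complex.I ^ n * Complex.exp (Complex.I * t) := by
    intro n
    induction n with
    | zero => simp
    | succ n ih =>
      rw [iteratedDeriv_succ, ih]
      funext t
      have h : HasDerivAt (fun t : ℝ => Complex.I * (t : ℂ)) (Complex.I * 1) t :=
        (Complex.ofRealCLM.hasDerivAt (x := t)).const_mul _
      rw [(h.cexp.const_mul (Complex.I ^ n)).deriv]
      ring
  have hc : ContDiff ℝ ∞ (fun t : ℝ => Complex.exp (Complex.I * t)) :=
    (contDiff_const.mul Complex.ofRealCLM.contDiff).cexp
  refine ⟨hc, fun n => ⟨0, 1, fun t => ?_⟩⟩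
  rw [norm_iteratedFDeriv_eq_norm_iteratedDeriv, hd]
  simp [Complex.norm_exp]

theorem exists_schwartz_gaussian_phase {c : ℝ} (hc : 0 < c) (d : ℝ) :
    ∃ s : 𝓢(ℝ × ℝ, ℂ), ∀ x, s x
      = Complex.exp (-(c / 2 : ℝ) * (x.1 ^ 2 + x.2 ^ 2) + Complex.I * (d * x.1 * x.2 : ℝ)) := by
  have hc' : √c ≠ 0 := by positivity
  let e : ℝ ≃L[ℝ] ℝ := ContinuousLinearEquiv.unitsEquivAut ℝ (Units.mk0 (√c) hc')
  have h1 : Function.HasTemperateGrowth (fun x : ℝ × ℝ => x.1) :=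
    (ContinuousLinearMap.fst ℝ ℝ ℝ).hasTemperateGrowth
  have h2 : Function.HasTemperateGrowth (fun x : ℝ × ℝ => x.2) :=
    (ContinuousLinearMap.snd ℝ ℝ ℝ).hasTemperateGrowth
  have hg : Function.HasTemperateGrowth (fun x : ℝ × ℝ => d * x.1 * x.2) := by fun_prop
  have hp : Function.HasTemperateGrowth
      (fun x : ℝ × ℝ => Complex.exp (Complex.I * (d * x.1 * x.2 : ℝ))) :=
    hasTemperateGrowth_cexp_I_mul.comp hg
  refine ⟨smulLeftCLM ℂ (fun x : ℝ × ℝ => Complex.exp (Complex.I * (d * x.1 * x.2 : ℝ)))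
    (postcompCLM Complex.ofRealCLM (compCLMOfContinuousLinearEquiv ℝ (e.prodCongr e)
      gaussianSchwartzPlane)), fun x => ?_⟩
  rw [smulLeftCLM_apply_apply hp, postcompCLM_apply,
    compCLMOfContinuousLinearEquiv_apply, Function.comp_apply, gaussianSchwartzPlane_apply,
    smul_eq_mul, Complex.ofRealCLM_apply, Complex.ofReal_exp, ← Complex.exp_add, add_comm]
  congr 2
  have h1 : (e.prodCongr e x).1 = x.1 * √c := rfl
  have h2 : (e.prodCongr e x).2 = x.2 * √c := rfl
  rw [h1, h2, mul_pow, mul_pow, Real.sq_sqrt hc.le]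
  push_cast
  ring

/-- The transform of two centered Gaussians is a Schwartz function. -/
theorem exists_schwartz_eq_wignerTransform_gaussian {b : ℝ} (hb : b ≠ 0) :
    ∃ s : 𝓢(ℝ × ℝ, ℂ), (s : ℝ × ℝ → ℂ)
      = wignerTransform b (driftGaussian |b| 0) (driftGaussian |b|⁻¹ 0) := by
  have hb' : 0 < |b| / 2 := by positivity
  have hbC : (b : ℂ) ≠ 0 := by exact_mod_cast hb
  have hsq : ((|b| : ℝ) : ℂ) * ((|b| : ℝ) : ℂ) = b * b := by
    rw [← Complex.ofReal_mul, abs_mul_abs_self, Complex.ofReal_mul]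
  -- Expanding the square for zero drifts, with `|b|² = b²`, leaves `-|b| (x₁² + x₂²) / 4 - i b x₁
  -- x₂ / 2`.
  obtain ⟨s, hs⟩ := exists_schwartz_gaussian_phase hb' (-(b / 2))
  refine ⟨gaussianTransformCoeff b • s, ?_⟩
  funext x
  rw [wignerTransform_driftGaussian hb, smul_apply, hs, smul_eq_mul]
  congr 2
  push_cast
  field_simp
  linear_combination (-4 * (|b| : ℝ) * x.1 ^ 2 + 8 * Complex.I * b * x.1 * x.2) * hsq
    + (-4 * b ^ 2 * (|b| : ℝ) * x.2 ^ 2) * Complex.I_mul_I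

/-! ### Schwartz functions in the range of the transform -/

theorem eq_of_forall_inner_toLp {f g : L2Plane}
    (h : ∀ u : 𝓢(ℝ × ℝ, ℂ), ⟪u.toLp 2 volume, f⟫_ℂ = ⟪u.toLp 2 volume, g⟫_ℂ) : f = g :=
  (SchwartzMap.denseRange_toLpCLM (F := ℂ) (p := 2) (by norm_num)
    (μ := (volume : Measure (ℝ × ℝ)))).eq_of_inner_right (𝕜 := ℂ) h

theorem inner_toLp_toLp (u v : 𝓢(ℝ × ℝ, ℂ)) :
    ⟪u.toLp 2 volume, v.toLp 2 volume⟫_ℂ = ∫ x, conjSchwartz u x * v x := by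
  rw [L2.inner_def]
  refine integral_congr_ae ?_
  filter_upwards [u.coeFn_toLp 2 volume, v.coeFn_toLp 2 volume] with x h1 h2
  rw [h1, h2, RCLike.inner_apply, conjSchwartz_apply, mul_comm]

theorem inner_lineDerivOp_toLp (u v : 𝓢(ℝ × ℝ, ℂ)) (m : ℝ × ℝ) :
    ⟪(∂_{m} u : 𝓢(ℝ × ℝ, ℂ)).toLp 2 volume, v.toLp 2 volume⟫_ℂ
      = -⟪u.toLp 2 volume, (∂_{m} v : 𝓢(ℝ × ℝ, ℂ)).toLp 2 volume⟫_ℂ := by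
  rw [inner_toLp_toLp, inner_toLp_toLp,
    integral_mul_lineDerivOp_right_eq_neg_left (conjSchwartz u) v m, neg_neg]
  simp only [lineDerivOp_conjSchwartz, conjSchwartz_apply]

theorem inner_momentumTwo_toLp (b : ℝ) (u v : 𝓢(ℝ × ℝ, ℂ)) :
    ⟪(momentumTwo b u).toLp 2 volume, v.toLp 2 volume⟫_ℂ
      = ⟪u.toLp 2 volume, (momentumTwo b v).toLp 2 volume⟫_ℂ := by
  have hg : Function.HasTemperateGrowth (fun x : ℝ × ℝ => ((b * x.1 : ℝ) : ℂ)) :=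
    ((Complex.ofRealCLM.comp (b • ContinuousLinearMap.fst ℝ ℝ ℝ)).hasTemperateGrowth :)
  have e : ∀ w : 𝓢(ℝ × ℝ, ℂ), momentumTwo b w
      = (-Complex.I) • (∂_{((0, 1) : ℝ × ℝ)} w : 𝓢(ℝ × ℝ, ℂ))
        + smulLeftCLM ℂ (fun x : ℝ × ℝ => ((b * x.1 : ℝ) : ℂ)) w := fun _ => rfl
  rw [e, e, toLp_add_apply, toLp_add_apply, toLp_smul_apply, toLp_smul_apply, inner_add_left,
    inner_add_right, inner_smul_left, inner_smul_right, inner_lineDerivOp_toLp]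
  congr 1
  · simp
  · rw [inner_toLp_toLp, inner_toLp_toLp]
    congr 1
    funext x
    rw [conjSchwartz_apply, smulLeftCLM_apply_apply hg, smulLeftCLM_apply_apply hg,
      conjSchwartz_apply, smul_eq_mul, smul_eq_mul, map_mul, Complex.conj_ofReal]
    ring

/-- When the image is Schwartz, the weak relation becomes an identity in `L²`. With
`wignerCLM_positionCLM_eq` it shows that raising `φ` keeps the image Schwartz. -/
theorem wignerCLM_derivCLM_eq {b : ℝ} (hb : b ≠ 0) {φ : 𝓢(ℝ, ℂ)} {g : L2Line} {s : 𝓢(ℝ × ℝ, ℂ)}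
    (h : wignerCLM hb (φ.toLp 2) g = s.toLp 2) :
    wignerCLM hb ((derivCLM ℂ ℂ φ).toLp 2) g
      = (∂_{((1, 0) : ℝ × ℝ)} s : 𝓢(ℝ × ℝ, ℂ)).toLp 2 := by
  refine eq_of_forall_inner_toLp fun u => ?_
  have h1 := inner_lineDerivOp_one_wignerCLM hb u φ g
  rw [h, inner_lineDerivOp_toLp] at h1
  exact (neg_injective h1).symm

theorem wignerCLM_positionCLM_eq {b : ℝ} (hb : b ≠ 0) {φ : 𝓢(ℝ, ℂ)} {g : L2Line}
    {s : 𝓢(ℝ × ℝ, ℂ)} (h : wignerCLM hb (φ.toLp 2) g = s.toLp 2) :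
    wignerCLM hb ((positionCLM φ).toLp 2) g = ((b : ℂ)⁻¹ • momentumTwo b s).toLp 2 := by
  refine eq_of_forall_inner_toLp fun u => ?_
  have h1 := inner_momentumTwo_wignerCLM hb u φ g
  have hbC : (b : ℂ) ≠ 0 := by exact_mod_cast hb
  rw [h, inner_momentumTwo_toLp] at h1
  rw [toLp_smul_apply, inner_smul_right, h1, inv_mul_cancel_left₀ hbC]

theorem wignerTransform_modulation (b η : ℝ) (φ g : ℝ → ℂ) (x : ℝ × ℝ) :
    wignerTransform b φ (fun k => Complex.exp (Complex.I * η * k) * g k) x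
      = wignerTransform b φ g (x - (0, η)) := by
  rw [wignerTransform, wignerTransform]
  congr 2
  funext k
  have e : Complex.exp (-Complex.I * k * ((x.2 - η : ℝ) : ℂ))
      = Complex.exp (-Complex.I * k * x.2) * Complex.exp (Complex.I * η * k) := by
    rw [← Complex.exp_add]
    congr 1
    push_cast
    ring
  simp only [wignerIntegrand, Prod.fst_sub, Prod.snd_sub, sub_zero, e]
  ring

/-- The Gaussian `exp (-k² / (2 |b|) + i η k)` as an element of `L²(ℝ)`. -/
def modulatedGaussian {b : ℝ} (hb : b ≠ 0) (η : ℝ) : L2Line :=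
  (memLp_driftGaussian (a := |b|⁻¹) (by positivity) (Complex.I * η)).toLp _

/-- These are the transforms that may serve as test functions in `landauGraph`. For `n = 0` the
image is an explicit Gaussian, and modulating `g` only translates it in `x₂`; the raising operator
then acts on images through `momentumTwo` and `∂₁`, which preserve Schwartz functions. -/
theorem exists_schwartz_eq_wignerCLM_hermiteLp {b : ℝ} (hb : b ≠ 0) (n : ℕ) (η : ℝ) :
    ∃ s : 𝓢(ℝ × ℝ, ℂ), wignerCLM hb (hermiteLp hb n) (modulatedGaussian hb η) = s.toLp 2 := by
  induction n with
  | zero =>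
    obtain ⟨s, hs⟩ := exists_schwartz_eq_wignerTransform_gaussian hb
    refine ⟨((hermiteCoeff b 0 : ℝ) : ℂ) • compSubConstCLM ℂ ((0, η) : ℝ × ℝ) s, ?_⟩
    have h0 : hermiteLp hb 0 = ((hermiteCoeff b 0 : ℝ) : ℂ) • (groundSchwartz b hb).toLp 2 volume := by
      rw [hermiteLp, hermiteSchwartz, toLp_smul_apply]
    rw [h0, map_smul, smul_apply, toLp_smul_apply]
    congr 1
    refine Lp.ext ?_
    refine (coeFn_wignerCLM hb _ _).trans (Filter.EventuallyEq.trans ?_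
      (SchwartzMap.coeFn_toLp _ 2 volume).symm)
    rw [modulatedGaussian, wignerTransform_congr hb ((groundSchwartz b hb).coeFn_toLp 2 volume)
      (MemLp.coeFn_toLp (memLp_driftGaussian (a := |b|⁻¹) (by positivity) (Complex.I * η)))]
    refine Filter.Eventually.of_forall fun x => ?_
    rw [compSubConstCLM_apply, hs, ← wignerTransform_modulation]
    congr 1
    · funext t
      rw [groundSchwartz_apply, driftGaussian]
      push_cast
      congr 1
      ring
    · funext k
      rw [driftGaussian, driftGaussian, ← Complex.exp_add]
      congr 1
      ring
  | succ n ih =>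
    obtain ⟨s, hs⟩ := ih
    refine ⟨((ladderCoeff b (n + 1) : ℝ) : ℂ)⁻¹ • (((|b| : ℝ) : ℂ) • ((b : ℂ)⁻¹ • momentumTwo b s)
      - (∂_{((1, 0) : ℝ × ℝ)} s : 𝓢(ℝ × ℝ, ℂ))), ?_⟩
    have hsub : ∀ f g : 𝓢(ℝ × ℝ, ℂ), (f - g).toLp 2 volume
      = f.toLp 2 volume - g.toLp 2 volume := fun f g => (toLpCLM ℂ ℂ 2 volume).map_sub f g
    have hsub' : ∀ f g : 𝓢(ℝ, ℂ), (f - g).toLp 2 volume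
      = f.toLp 2 volume - g.toLp 2 volume := fun f g => (toLpCLM ℂ ℂ 2 volume).map_sub f g
    rw [hermiteLp, hermiteSchwartz, raiseCLM_apply, toLp_smul_apply, hsub', toLp_smul_apply,
      map_smul, map_sub, map_smul, smul_apply, sub_apply, smul_apply, toLp_smul_apply, hsub,
      toLp_smul_apply, wignerCLM_derivCLM_eq hb hs, wignerCLM_positionCLM_eq hb hs]

/-- A square integrable function orthogonal to all modulated Gaussians vanishes. -/
theorem eq_zero_of_forall_inner_modulatedGaussian {b : ℝ} (hb : b ≠ 0) {r : L2Line}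
    (h : ∀ η : ℝ, ⟪modulatedGaussian hb η, r⟫_ℂ = 0) : r = 0 := by
  have hm := memLp_driftGaussian (a := |b|⁻¹) (by positivity) 0
  have hz : (fun k => driftGaussian |b|⁻¹ 0 k * r k) =ᵐ[volume] 0 := by
    refine ae_eq_zero_of_forall_integral_exp_mul (hm.integrable_mul (Lp.memLp r)) fun ξ => ?_
    -- The inner product conjugates its first argument, hence the sign.
    refine Eq.trans ?_ (h (-ξ))
    rw [L2.inner_def]
    refine integral_congr_ae ?_
    filter_upwards [(memLp_driftGaussian (a := |b|⁻¹) (by positivity)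
      (Complex.I * (-ξ : ℝ))).coeFn_toLp] with k hk
    rw [modulatedGaussian, hk, RCLike.inner_apply, mul_comm (r k), ← mul_assoc, driftGaussian,
      driftGaussian, ← Complex.exp_conj, ← Complex.exp_add]
    congr 2
    simp only [map_add, map_mul, map_neg, map_pow, Complex.conj_ofReal, Complex.conj_I]
    push_cast
    ring
  rw [Lp.eq_zero_iff_ae_eq_zero]
  filter_upwards [hz] with k hk
  exact (mul_eq_zero.1 hk).resolve_left (Complex.exp_ne_zero _)

/-- Pairs in the graph of the Landau operator satisfy the eigenvalue relation in every Landau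
level. -/
theorem inner_wignerCLM_of_mem_landauGraph {b : ℝ} (hb : b ≠ 0) {p : L2Plane × L2Plane}
    (hp : p ∈ landauGraph b) (n : ℕ) (g : L2Line) :
    ⟪wignerCLM hb (hermiteLp hb n) g, p.2⟫_ℂ
      = (landauLevel b n : ℂ) * ⟪wignerCLM hb (hermiteLp hb n) g, p.1⟫_ℂ := by
  set T := wignerCLM hb (hermiteLp hb n) with hT
  -- Passing to the adjoint, it suffices to test on modulated Gaussians, whose transforms are
  -- Schwartz and thus admissible in `hp`.
  have hr : ContinuousLinearMap.adjoint T (p.2 - (landauLevel b n : ℂ) • p.1) = 0 := by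
    refine eq_zero_of_forall_inner_modulatedGaussian hb fun η => ?_
    obtain ⟨s, hs⟩ := exists_schwartz_eq_wignerCLM_hermiteLp hb n η
    -- Formal symmetry moves the operator from `u` to `s`, so `s` is an eigenfunction in the strong
    -- sense.
    have hL : (landauSchwartz b s).toLp 2 volume = (landauLevel b n : ℂ) • s.toLp 2 volume := by
      refine eq_of_forall_inner_toLp fun u => ?_
      have h1 := inner_landauSchwartz_wignerCLM hb u n (modulatedGaussian hb η)
      have e : ∀ w : 𝓢(ℝ × ℝ, ℂ), landauSchwartz b w
          = -(∂_{((1, 0) : ℝ × ℝ)} (∂_{((1, 0) : ℝ × ℝ)} w : 𝓢(ℝ × ℝ, ℂ)) : 𝓢(ℝ × ℝ, ℂ))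
            + momentumTwo b (momentumTwo b w) := fun _ => rfl
      rw [hs] at h1
      rw [inner_smul_right, ← h1, e, e, toLp_add_apply, toLp_add_apply, toLp_neg_apply,
        toLp_neg_apply, inner_add_left, inner_add_right, inner_neg_left, inner_neg_right,
        inner_lineDerivOp_toLp, inner_lineDerivOp_toLp, inner_momentumTwo_toLp,
        inner_momentumTwo_toLp, neg_neg]
    rw [ContinuousLinearMap.adjoint_inner_right, hT, hs, inner_sub_right, hp s, hL, inner_smul_left,
      inner_smul_right, Complex.conj_ofReal, sub_self]
  have := ContinuousLinearMap.adjoint_inner_right T g (p.2 - (landauLevel b n : ℂ) • p.1)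
  rw [hr, inner_zero_right, inner_sub_right, inner_smul_right] at this
  exact sub_eq_zero.1 this.symm

/-! ### Completeness -/

/-- The transforms `𝒲(φₙ, g)` are total in `L²(ℝ²)`. -/
theorem eq_zero_of_forall_inner_wignerCLM {b : ℝ} (hb : b ≠ 0) {f : L2Plane}
    (h : ∀ n g, ⟪wignerCLM hb (hermiteLp hb n) g, f⟫_ℂ = 0) : f = 0 := by
  -- For fixed `g`, the adjoint of `φ ↦ 𝒲(φ, g)` sends `f` to a vector orthogonal to all Hermite
  -- functions, hence to zero.
  have hall : ∀ φ g, ⟪wignerCLM hb φ g, f⟫_ℂ = 0 := by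
    intro φ g
    have hr : ContinuousLinearMap.adjoint ((wignerCLM hb).flip g) f = 0 := by
      rw [Lp.eq_zero_iff_ae_eq_zero]
      refine ae_eq_zero_of_forall_integral_hermiteSchwartz_mul b hb (Lp.memLp _) fun n => ?_
      rw [← h n g, ← ContinuousLinearMap.flip_apply, ← ContinuousLinearMap.adjoint_inner_right,
        L2.inner_def]
      refine integral_congr_ae ?_
      filter_upwards [(hermiteSchwartz b hb n).coeFn_toLp 2 volume] with t ht
      rw [hermiteLp, ht, RCLike.inner_apply, hermiteSchwartz_apply, Complex.conj_ofReal, mul_comm]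
    rw [← ContinuousLinearMap.flip_apply, ← ContinuousLinearMap.adjoint_inner_right, hr,
      inner_zero_right]
  have hb' : 0 < |b| := abs_pos.2 hb
  have hbi : 0 < |b|⁻¹ := inv_pos.2 hb'
  have hbC : (b : ℂ) ≠ 0 := by exact_mod_cast hb
  have hbC' : ((|b| : ℝ) : ℂ) ≠ 0 := by exact_mod_cast hb'.ne'
  have hint : ∀ v w : ℂ, ∫ x, wignerTransform b (driftGaussian |b| v) (driftGaussian |b|⁻¹ w) x
      * starRingEnd ℂ (f x) = 0 := by
    intro v w
    have h1 := hall ((memLp_driftGaussian hb' v).toLp _) ((memLp_driftGaussian hbi w).toLp _)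
    rw [wignerCLM_toLp, ← inner_conj_symm, map_eq_zero, L2.inner_def] at h1
    rw [← h1]
    refine integral_congr_ae ?_
    filter_upwards [(memLp_wignerTransform hb (memLp_driftGaussian hb' v)
      (memLp_driftGaussian hbi w)).coeFn_toLp] with x hx
    rw [hx, RCLike.inner_apply]
  have hfc : MemLp (fun x => starRingEnd ℂ (f x)) 2 := (Lp.memLp f).star
  have hz : (fun x => wignerTransform b (driftGaussian |b| 0) (driftGaussian |b|⁻¹ 0) x
      * starRingEnd ℂ (f x)) =ᵐ[volume] 0 := by
    refine ae_eq_zero_of_forall_integral_exp_mul_plane ((memLp_wignerTransform hb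
      (memLp_driftGaussian hb' 0) (memLp_driftGaussian hbi 0)).integrable_mul hfc) fun ξ η => ?_
    -- The second drift gives `w - v / b = -2 η / |b|`, whose cross term is `i η x₂ - η (|b| / b)
    -- x₁`; the real part of `v` cancels the last summand. What remains is the character times the
    -- constant in `h3`.
    have h2 := hint (Complex.I * ξ + η * (|b| : ℝ) / b)
      (-2 * η / (|b| : ℝ) + (Complex.I * ξ + η * (|b| : ℝ) / b) / b)
    have h3 : Complex.exp ((|b| : ℝ) / 4 * (-2 * η / (|b| : ℝ)) ^ 2) ≠ 0 := Complex.exp_ne_zero _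
    refine mul_left_cancel₀ h3 ?_
    rw [mul_zero, ← integral_const_mul]
    refine Eq.trans ?_ h2
    congr 1
    funext x
    rw [wignerTransform_driftGaussian hb, wignerTransform_driftGaussian hb]
    rw [← mul_assoc, ← mul_assoc]
    congr 1
    rw [mul_left_comm, ← Complex.exp_add, ← Complex.exp_add]
    congr 2
    field_simp
    ring
  rw [Lp.eq_zero_iff_ae_eq_zero]
  filter_upwards [hz] with x hx
  have := (mul_eq_zero.1 hx).resolve_left (by
    rw [wignerTransform_driftGaussian hb]
    exact mul_ne_zero (gaussianTransformCoeff_ne_zero hb) (Complex.exp_ne_zero _))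
  simpa using this

/-! ### Operators that are diagonal in a Hilbert basis -/

section Diagonal

variable {H : Type*} [NormedAddCommGroup H] [InnerProductSpace ℂ H] {ι : Type*}

theorem HilbertBasis.ext_inner (e : HilbertBasis ι ℂ H) {x y : H}
    (h : ∀ i, ⟪e i, x⟫_ℂ = ⟪e i, y⟫_ℂ) : x = y := by
  refine e.repr.injective (lp.ext (funext fun i => ?_))
  rw [e.repr_apply_apply, e.repr_apply_apply, h i]

/-- A bounded sequence defines a bounded diagonal operator. -/
theorem HilbertBasis.exists_diagonal (e : HilbertBasis ι ℂ H) (c : ι → ℂ) {C : ℝ} (hC : 0 ≤ C)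
    (hc : ∀ i, ‖c i‖ ≤ C) : ∃ R : H →L[ℂ] H, ∀ x i, ⟪e i, R x⟫_ℂ = c i * ⟪e i, x⟫_ℂ := by
  have hle : ∀ (x : H) (i : ι), ‖c i * e.repr x i‖ ^ 2 ≤ C ^ 2 * ‖e.repr x i‖ ^ 2 := by
    intro x i
    rw [norm_mul, mul_pow]
    gcongr
    exact hc i
  have hsx : ∀ x : H, Summable fun i => ‖e.repr x i‖ ^ 2 := by
    intro x
    simpa using (lp.memℓp (e.repr x)).summable (by norm_num)
  have hmem : ∀ x : H, Memℓp (fun i => c i * e.repr x i) 2 := by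
    intro x
    refine memℓp_gen ?_
    simpa using Summable.of_nonneg_of_le (fun i => by positivity) (hle x) ((hsx x).mul_left (C ^ 2))
  let D : H →ₗ[ℂ] (lp (fun _ : ι => ℂ) 2) :=
    { toFun := fun x => ⟨fun i => c i * e.repr x i, hmem x⟩
      map_add' := by
        intro x y
        refine lp.ext (funext fun i => ?_)
        change c i * e.repr (x + y) i = c i * e.repr x i + c i * e.repr y i
        rw [map_add, lp.coeFn_add, Pi.add_apply, mul_add]
      map_smul' := by
        intro a x
        refine lp.ext (funext fun i => ?_)
        change c i * e.repr (a • x) i = a * (c i * e.repr x i)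
        rw [map_smul, lp.coeFn_smul, Pi.smul_apply, smul_eq_mul, mul_left_comm] }
  have hD : ∀ x, ‖D x‖ ≤ C * ‖x‖ := by
    intro x
    refine lp.norm_le_of_tsum_le (by norm_num) (by positivity) ?_
    have h1 := (Summable.of_nonneg_of_le (fun i => by positivity) (hle x)
      ((hsx x).mul_left (C ^ 2))).tsum_le_tsum (hle x) ((hsx x).mul_left (C ^ 2))
    have h2 : ‖x‖ ^ 2 = ∑' i, ‖e.repr x i‖ ^ 2 := by
      have := lp.norm_rpow_eq_tsum (p := 2) (by norm_num) (e.repr x)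
      simpa using this
    rw [tsum_mul_left, ← h2, ← mul_pow] at h1
    have h3 : ∑' i, ‖D x i‖ ^ 2 ≤ (C * ‖x‖) ^ 2 := h1
    simpa using h3
  refine ⟨(e.repr.symm.toContinuousLinearEquiv : (lp (fun _ : ι => ℂ) 2) →L[ℂ] H) ∘L D.mkContinuous C hD,
    fun x i => ?_⟩
  rw [← e.repr_apply_apply, ← e.repr_apply_apply]
  change e.repr (e.repr.symm (D x)) i = _
  rw [LinearIsometryEquiv.apply_symm_apply]
  rfl

-- `hT` makes `T` the multiplication by the real sequence `a`, in the coordinates of `e`, on its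
-- maximal domain.
variable (e : HilbertBasis ι ℂ H) (a : ι → ℝ) {T : H →ₗ.[ℂ] H}
  (hT : ∀ p, p ∈ T.graph ↔ ∀ i, ⟪e i, p.2⟫_ℂ = (a i : ℂ) * ⟪e i, p.1⟫_ℂ)

include hT

theorem mem_pmapEigenspace_iff_of_diagonal (z : ℂ) (f : H) :
    f ∈ pmapEigenspace T z ↔ ∀ i, (a i : ℂ) = z ∨ ⟪e i, f⟫_ℂ = 0 := by
  have h1 : f ∈ pmapEigenspace T z ↔ (f, z • f) ∈ T.graph := by
    rw [LinearPMap.mem_graph_iff]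
    constructor
    · rintro ⟨hf, h⟩
      exact ⟨⟨f, hf⟩, rfl, h⟩
    · rintro ⟨⟨y, hy⟩, e1, e2⟩
      subst e1
      exact ⟨hy, e2⟩
  rw [h1, hT]
  refine forall_congr' fun i => ?_
  rw [inner_smul_right, mul_eq_mul_right_iff, eq_comm (a := z)]

theorem basis_mem_pmapEigenspace_of_diagonal (i : ι) : e i ∈ pmapEigenspace T (a i) := by
  rw [mem_pmapEigenspace_iff_of_diagonal e a hT]
  intro j
  by_cases h : j = i
  · exact Or.inl (by rw [h])
  · exact Or.inr (e.orthonormal.2 h)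

theorem dense_domain_of_diagonal : Dense (T.domain : Set H) := by
  have h : Submodule.span ℂ (Set.range e) ≤ T.domain := by
    rw [Submodule.span_le]
    rintro _ ⟨i, rfl⟩
    exact (basis_mem_pmapEigenspace_of_diagonal e a hT i).1
  refine Dense.mono h ?_
  rw [dense_iff_closure_eq, ← Submodule.topologicalClosure_coe, e.dense_span, Submodule.top_coe]

/-- Testing the adjoint relation on basis vectors gives the diagonal relation because `a` is real;
Parseval gives the converse. -/
theorem isSelfAdjoint_of_diagonal [CompleteSpace H] : IsSelfAdjoint T := by
  rw [LinearPMap.isSelfAdjoint_def]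
  refine LinearPMap.eq_of_eq_graph ?_
  rw [LinearPMap.adjoint_graph_eq_graph_adjoint (dense_domain_of_diagonal e a hT)]
  ext p
  rw [Submodule.mem_adjoint_iff, hT]
  constructor
  · intro h i
    obtain ⟨hd, he⟩ := basis_mem_pmapEigenspace_of_diagonal e a hT i
    have h1 := h (e i) ((a i : ℂ) • e i) (by rw [← he]; exact T.mem_graph ⟨e i, hd⟩)
    rw [inner_smul_left, Complex.conj_ofReal, sub_eq_zero] at h1
    exact h1.symm
  · intro h x y hxy
    rw [hT] at hxy
    rw [sub_eq_zero, ← e.tsum_inner_mul_inner, ← e.tsum_inner_mul_inner x p.2]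
    congr 1
    funext i
    have h2 : ⟪y, e i⟫_ℂ = (a i : ℂ) * ⟪x, e i⟫_ℂ := by
      rw [← inner_conj_symm, hxy i, map_mul, Complex.conj_ofReal, inner_conj_symm]
    rw [h i, h2]
    ring

theorem hasPurePointSpectrum_of_diagonal : HasPurePointSpectrum T := by
  have h : Submodule.span ℂ (Set.range e) ≤ ⨆ z : ℂ, pmapEigenspace T z := by
    rw [Submodule.span_le]
    rintro _ ⟨i, rfl⟩
    exact Submodule.mem_iSup_of_mem (a i : ℂ) (basis_mem_pmapEigenspace_of_diagonal e a hT i)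
  rw [HasPurePointSpectrum, eq_top_iff, ← e.dense_span]
  exact Submodule.topologicalClosure_mono h

/-- Away from the values of `a` the resolvent is diagonal with entries `1 / (a i - z)`, bounded by
`1 / δ`; at `z = a i` a left inverse would have to send `0` to `e i`. -/
theorem pmapSpectrum_eq_of_diagonal
    (ha : ∀ z : ℂ, z ∉ Set.range (fun i => (a i : ℂ)) → ∃ δ > 0, ∀ i, δ ≤ ‖(a i : ℂ) - z‖) :
    pmapSpectrum T = Set.range (fun i => (a i : ℂ)) := by
  ext z
  constructor
  · contrapose
    intro hz hs
    refine hs ?_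
    obtain ⟨δ, hδ, hle⟩ := ha z hz
    have hne : ∀ i, (a i : ℂ) - z ≠ 0 := fun i =>
      norm_pos_iff.1 (hδ.trans_le (hle i))
    obtain ⟨R, hR⟩ := e.exists_diagonal (fun i => ((a i : ℂ) - z)⁻¹) (C := δ⁻¹) (by positivity)
      (fun i => by rw [norm_inv]; exact inv_anti₀ hδ (hle i))
    refine ⟨R, fun y => ?_, fun x => ?_⟩
    · have hg : (R y, y + z • R y) ∈ T.graph := by
        rw [hT]
        intro i
        rw [inner_add_right, inner_smul_right, hR]
        field_simp [hne i]
        ring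
      rw [LinearPMap.mem_graph_iff] at hg
      obtain ⟨⟨w, hw⟩, e1, e2⟩ := hg
      simp only at e1 e2
      subst e1
      exact ⟨hw, by rw [e2, add_sub_cancel_right]⟩
    · refine e.ext_inner fun i => ?_
      have h1 := (hT _).1 (T.mem_graph x) i
      simp only at h1
      rw [hR, inner_sub_right, h1, inner_smul_right, ← sub_mul, inv_mul_cancel_left₀ (hne i)]
  · rintro ⟨i, rfl⟩ ⟨R, -, h2⟩
    obtain ⟨hd, he⟩ := basis_mem_pmapEigenspace_of_diagonal e a hT i
    have h3 := h2 ⟨e i, hd⟩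
    simp only at h3
    rw [he, sub_self, map_zero] at h3
    have h4 := e.orthonormal.1 i
    rw [← h3, norm_zero] at h4
    exact zero_ne_one h4

end Diagonal

/-! ### Landau levels -/

theorem coeFn_hermiteLp {b : ℝ} (hb : b ≠ 0) (n : ℕ) :
    hermiteLp hb n =ᵐ[volume] fun t => (hermiteFun b n t : ℂ) := by
  filter_upwards [(hermiteSchwartz b hb n).coeFn_toLp 2 volume] with t ht
  rw [hermiteLp, ht, hermiteSchwartz_apply]

theorem coe_hermiteSchwartz {b : ℝ} (hb : b ≠ 0) (n : ℕ) :
    (hermiteSchwartz b hb n : ℝ → ℂ) = fun t => (hermiteFun b n t : ℂ) :=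
  funext (hermiteSchwartz_apply b hb n)

theorem memLp_hermiteFun {b : ℝ} (hb : b ≠ 0) (n : ℕ) :
    MemLp (fun t => (hermiteFun b n t : ℂ)) 2 := by
  rw [← coe_hermiteSchwartz hb]
  exact (hermiteSchwartz b hb n).memLp 2

theorem norm_hermiteLp {b : ℝ} (hb : b ≠ 0) (n : ℕ) : ‖hermiteLp hb n‖ = 1 := by
  have h : ⟪hermiteLp hb n, hermiteLp hb n⟫_ℂ = 1 := by
    rw [L2.inner_def, ← integral_hermiteSchwartz_mul_self b hb n]
    refine integral_congr_ae ?_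
    filter_upwards [coeFn_hermiteLp hb n] with t ht
    rw [ht, RCLike.inner_apply, Complex.conj_ofReal, hermiteSchwartz_apply]
  have h2 : ‖hermiteLp hb n‖ ^ 2 = 1 := by
    rw [norm_sq_eq_re_inner (𝕜 := ℂ), h, RCLike.one_re]
  exact (pow_eq_one_iff_of_nonneg (norm_nonneg _) two_ne_zero).1 h2

/-- The isometry `g ↦ 𝒲(φₙ, g)` of `L²(ℝ)` into `L²(ℝ²)`. -/
def landauEmbedding {b : ℝ} (hb : b ≠ 0) (n : ℕ) : L2Line →ₗᵢ[ℂ] L2Plane :=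
  ⟨(wignerCLM hb (hermiteLp hb n)).toLinearMap, fun g => by
    change ‖wignerCLM hb (hermiteLp hb n) g‖ = ‖g‖
    rw [norm_wignerCLM, norm_hermiteLp, one_mul]⟩

theorem landauEmbedding_apply {b : ℝ} (hb : b ≠ 0) (n : ℕ) (g : L2Line) :
    landauEmbedding hb n g = wignerCLM hb (hermiteLp hb n) g := rfl

theorem coeFn_landauEmbedding {b : ℝ} (hb : b ≠ 0) (n : ℕ) (g : L2Line) :
    landauEmbedding hb n g =ᵐ[volume] wignerTransform b (fun t => (hermiteFun b n t : ℂ)) g := by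
  rw [← wignerTransform_congr hb (coeFn_hermiteLp hb n) (ae_eq_refl _)]
  exact coeFn_wignerCLM hb _ g

theorem landauEmbedding_mem_landauGraph {b : ℝ} (hb : b ≠ 0) (n : ℕ) (g : L2Line) :
    (landauEmbedding hb n g, (landauLevel b n : ℂ) • landauEmbedding hb n g) ∈ landauGraph b := by
  intro u
  rw [inner_smul_right, landauEmbedding_apply, inner_landauSchwartz_wignerCLM]

theorem landauEmbedding_mem_eigenspace {b : ℝ} (hb : b ≠ 0) (n : ℕ) (g : L2Line) :
    landauEmbedding hb n g ∈ pmapEigenspace (landauOperator b) (landauLevel b n) :=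
  (mem_landauEigenspace_iff b _ _).2 (landauEmbedding_mem_landauGraph hb n g)

theorem inner_landauEmbedding_of_mem_landauGraph {b : ℝ} (hb : b ≠ 0) {p : L2Plane × L2Plane}
    (hp : p ∈ landauGraph b) (n : ℕ) (g : L2Line) :
    ⟪landauEmbedding hb n g, p.2⟫_ℂ = (landauLevel b n : ℂ) * ⟪landauEmbedding hb n g, p.1⟫_ℂ :=
  inner_wignerCLM_of_mem_landauGraph hb hp n g

theorem landauLevel_injective {b : ℝ} (hb : b ≠ 0) : Function.Injective (landauLevel b) := by
  intro m n h
  have h1 := mul_left_cancel₀ (abs_ne_zero.2 hb) h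
  have h2 : (m : ℝ) = n := by linarith
  exact_mod_cast h2

/-- The usual orthogonality for distinct eigenvalues, taken from the graph relation because
self-adjointness is only obtained later, from the basis built with it. -/
theorem inner_landauEmbedding_eq_zero {b : ℝ} (hb : b ≠ 0) {m n : ℕ} (hmn : m ≠ n) {f : L2Plane}
    (hf : f ∈ pmapEigenspace (landauOperator b) (landauLevel b n)) (g : L2Line) :
    ⟪landauEmbedding hb m g, f⟫_ℂ = 0 := by
  have h := inner_landauEmbedding_of_mem_landauGraph hb ((mem_landauEigenspace_iff b _ _).1 hf) m g
  rw [inner_smul_right] at h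
  refine (mul_eq_mul_right_iff.1 h).resolve_left fun h1 => hmn ?_
  exact (landauLevel_injective hb (by exact_mod_cast h1)).symm

/-- The transforms of a Hilbert basis of `L²(ℝ)` form a Hilbert basis of `L²(ℝ²)`. -/
theorem exists_hilbertBasis_landauEmbedding {b : ℝ} (hb : b ≠ 0) {ι : Type*}
    (β : HilbertBasis ι ℂ L2Line) :
    ∃ e : HilbertBasis (ℕ × ι) ℂ L2Plane, ∀ i, e i = landauEmbedding hb i.1 (β i.2) := by
  have ho : Orthonormal ℂ fun i : ℕ × ι => landauEmbedding hb i.1 (β i.2) := by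
    refine ⟨fun i => by rw [LinearIsometry.norm_map, β.orthonormal.1], fun i j hij => ?_⟩
    obtain ⟨m, k⟩ := i
    obtain ⟨n, l⟩ := j
    by_cases h : m = n
    · subst h
      simp only [LinearIsometry.inner_map_map]
      exact β.orthonormal.2 fun hkl => hij (by rw [hkl])
    · exact inner_landauEmbedding_eq_zero hb h (landauEmbedding_mem_eigenspace hb n _) _
  refine ⟨HilbertBasis.mkOfOrthogonalEqBot ho ?_, fun i => by
    rw [HilbertBasis.coe_mkOfOrthogonalEqBot]⟩
  rw [Submodule.eq_bot_iff]
  intro f hf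
  refine eq_zero_of_forall_inner_wignerCLM hb fun n g => ?_
  have h0 : ContinuousLinearMap.adjoint (wignerCLM hb (hermiteLp hb n)) f = 0 := by
    refine β.ext_inner fun l => ?_
    rw [ContinuousLinearMap.adjoint_inner_right, inner_zero_right]
    exact hf _ (Submodule.subset_span ⟨(n, l), rfl⟩)
  rw [← ContinuousLinearMap.adjoint_inner_right, h0, inner_zero_right]

/-- The graph of the Landau operator in terms of a Hilbert basis of eigenvectors. -/
theorem mem_landauGraph_iff {b : ℝ} (hb : b ≠ 0) {ι : Type*} {β : HilbertBasis ι ℂ L2Line}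
    {e : HilbertBasis (ℕ × ι) ℂ L2Plane} (he : ∀ i, e i = landauEmbedding hb i.1 (β i.2))
    (p : L2Plane × L2Plane) :
    p ∈ landauGraph b ↔ ∀ i, ⟪e i, p.2⟫_ℂ = (landauLevel b i.1 : ℂ) * ⟪e i, p.1⟫_ℂ := by
  constructor
  · intro hp i
    rw [he]
    exact inner_landauEmbedding_of_mem_landauGraph hb hp _ _
  · intro h u
    -- By Parseval it is enough to compare coefficients, and each basis vector is a distributional
    -- eigenvector.
    rw [← e.tsum_inner_mul_inner, ← e.tsum_inner_mul_inner _ p.1]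
    congr 1
    funext i
    rw [h i, he, landauEmbedding_apply, inner_landauSchwartz_wignerCLM]
    ring

theorem mem_landauOperator_graph_iff {b : ℝ} (hb : b ≠ 0) {ι : Type*} {β : HilbertBasis ι ℂ L2Line}
    {e : HilbertBasis (ℕ × ι) ℂ L2Plane} (he : ∀ i, e i = landauEmbedding hb i.1 (β i.2))
    (p : L2Plane × L2Plane) : p ∈ (landauOperator b).graph
      ↔ ∀ i, ⟪e i, p.2⟫_ℂ = (landauLevel b i.1 : ℂ) * ⟪e i, p.1⟫_ℂ := by
  rw [landauOperator_graph, mem_landauGraph_iff hb he]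

theorem isClosed_range_landauLevel {b : ℝ} (hb : b ≠ 0) :
    IsClosed (Set.range fun n : ℕ => (landauLevel b n : ℂ)) := by
  have h : (0 : ℝ) < 2 * |b| := by positivity
  refine (Topology.IsClosedEmbedding.isClosed_range
    (Metric.isClosedEmbedding_of_pairwise_le_dist h fun m n hmn => ?_))
  have h1 : (1 : ℝ) ≤ |(m : ℝ) - n| := by
    have : (1 : ℤ) ≤ |(m : ℤ) - n| := Int.one_le_abs (sub_ne_zero.2 (by exact_mod_cast hmn))
    exact_mod_cast this
  simp only
  rw [Complex.dist_eq, ← Complex.ofReal_sub, Complex.norm_real, Real.norm_eq_abs]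
  have h2 : landauLevel b m - landauLevel b n = 2 * |b| * ((m : ℝ) - n) := by
    unfold landauLevel
    ring
  rw [h2, abs_mul, abs_of_pos h]
  exact le_mul_of_one_le_right h.le h1

/-- The orthogonal projection onto a Landau level in terms of the isometry `g ↦ 𝒲(φₙ, g)`. -/
theorem starProjection_landauEigenspace {b : ℝ} (hb : b ≠ 0) (n : ℕ) (f : L2Plane) :
    (pmapEigenspace (landauOperator b) (landauLevel b n)).starProjection f
      = landauEmbedding hb n
        (ContinuousLinearMap.adjoint (landauEmbedding hb n).toContinuousLinearMap f) := by
  have hin : ∀ (v : L2Plane) (g : L2Line), ⟪landauEmbedding hb n g, v⟫_ℂ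
      = ⟪g, ContinuousLinearMap.adjoint (landauEmbedding hb n).toContinuousLinearMap v⟫_ℂ :=
    fun v g => (ContinuousLinearMap.adjoint_inner_right _ _ _).symm
  -- The difference is orthogonal to every `𝒲(φₘ, g)`: for `m = n` by isometry, for `m ≠ n` by
  -- orthogonality of the levels. Totality makes it zero, so the eigenspace is the range of the
  -- isometry.
  have hfix : ∀ v ∈ pmapEigenspace (landauOperator b) (landauLevel b n), v = landauEmbedding hb n
      (ContinuousLinearMap.adjoint (landauEmbedding hb n).toContinuousLinearMap v) := by
    intro v hv
    rw [← sub_eq_zero]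
    refine eq_zero_of_forall_inner_wignerCLM hb fun m g => ?_
    rw [← landauEmbedding_apply, inner_sub_right]
    by_cases h : m = n
    · subst h
      rw [LinearIsometry.inner_map_map, hin, sub_self]
    · rw [inner_landauEmbedding_eq_zero hb h hv, inner_landauEmbedding_eq_zero hb h
        (landauEmbedding_mem_eigenspace hb n _), sub_self]
  refine (Submodule.eq_starProjection_of_mem_of_inner_eq_zero
    (landauEmbedding_mem_eigenspace hb n _) fun v hv => ?_)
  rw [hfix v hv, inner_eq_zero_symm, inner_sub_right, LinearIsometry.inner_map_map, hin, sub_self]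

theorem mem_landauEigenspace_iff_exists {b : ℝ} (hb : b ≠ 0) (n : ℕ) (f : L2Plane) :
    f ∈ pmapEigenspace (landauOperator b) (landauLevel b n) ↔
      ∃ g : L2Line, f =ᵐ[volume] wignerTransform b (fun t => (hermiteFun b n t : ℂ)) g := by
  constructor
  · intro hf
    refine ⟨ContinuousLinearMap.adjoint (landauEmbedding hb n).toContinuousLinearMap f, ?_⟩
    have h := starProjection_landauEigenspace hb n f
    rw [Submodule.starProjection_eq_self_iff.2 hf] at h
    have h2 := coeFn_landauEmbedding hb n
      (ContinuousLinearMap.adjoint (landauEmbedding hb n).toContinuousLinearMap f)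
    rwa [← h] at h2
  · rintro ⟨g, hg⟩
    rw [Lp.ext (hg.trans (coeFn_landauEmbedding hb n g).symm)]
    exact landauEmbedding_mem_eigenspace hb n g

/-- The isometry `φ ↦ 𝒲(φ, φ₀)` carries distinct Hermite functions into distinct, hence orthogonal,
Landau levels. -/
theorem orthonormal_hermiteLp {b : ℝ} (hb : b ≠ 0) : Orthonormal ℂ (hermiteLp hb) := by
  refine ⟨norm_hermiteLp hb, fun m n hmn => ?_⟩
  let J : L2Line →ₗᵢ[ℂ] L2Plane :=
    ⟨((wignerCLM hb).flip (hermiteLp hb 0)).toLinearMap, fun φ => by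
      change ‖wignerCLM hb φ (hermiteLp hb 0)‖ = ‖φ‖
      rw [norm_wignerCLM, norm_hermiteLp, mul_one]⟩
  have h := inner_landauEmbedding_eq_zero hb hmn
    (landauEmbedding_mem_eigenspace hb n (hermiteLp hb 0)) (hermiteLp hb 0)
  exact (J.inner_map_map (hermiteLp hb m) (hermiteLp hb n)).symm.trans h

theorem not_finiteDimensional_landauEigenspace {b : ℝ} (hb : b ≠ 0) (n : ℕ) :
    ¬ FiniteDimensional ℂ (pmapEigenspace (landauOperator b) (landauLevel b n)) := by
  intro hfin
  let J : L2Line →ₗ[ℂ] pmapEigenspace (landauOperator b) (landauLevel b n) :=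
    (landauEmbedding hb n).toLinearMap.codRestrict _ (landauEmbedding_mem_eigenspace hb n)
  have hJ : Function.Injective J := fun g g' h =>
    (landauEmbedding hb n).injective (congrArg Subtype.val h)
  have : FiniteDimensional ℂ L2Line := FiniteDimensional.of_injective J hJ
  exact Module.Finite.not_linearIndependent_of_infinite _ (orthonormal_hermiteLp hb).linearIndependent

/-! ### The kernel of the projections -/

theorem landauKernelIntegrand_eq (b : ℝ) (n : ℕ) (x y : ℝ × ℝ) :
    landauKernelIntegrand b n x y = wignerIntegrand b (fun t => (hermiteFun b n t : ℂ))
      (fun k => (hermiteFun b n (y.1 - k / b) : ℂ)) (x.1, x.2 - y.2) := by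
  funext k
  simp only [landauKernelIntegrand, wignerIntegrand, Complex.ofReal_sub]

theorem integrable_landauKernelIntegrand {b : ℝ} (hb : b ≠ 0) (n : ℕ) (x y : ℝ × ℝ) :
    Integrable (landauKernelIntegrand b n x y) := by
  rw [landauKernelIntegrand_eq]
  exact integrable_wignerIntegrand hb (memLp_hermiteFun hb n)
    (memLp_comp_sub_div hb y.1 (memLp_hermiteFun hb n)) _

/-- The function `k ↦ exp (i k x₂) φₙ(x₁ - k / b)`. -/
def conjPlaneWave (b : ℝ) (n : ℕ) (x : ℝ × ℝ) (k : ℝ) : ℂ :=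
  Complex.exp (Complex.I * k * x.2) * (hermiteFun b n (x.1 - k / b) : ℂ)

theorem conj_conjPlaneWave (b : ℝ) (n : ℕ) (x : ℝ × ℝ) (k : ℝ) :
    starRingEnd ℂ (conjPlaneWave b n x k)
      = Complex.exp (-Complex.I * k * x.2) * (hermiteFun b n (x.1 - k / b) : ℂ) := by
  simp [conjPlaneWave, ← Complex.exp_conj]

theorem memLp_conjPlaneWave {b : ℝ} (hb : b ≠ 0) (n : ℕ) (x : ℝ × ℝ) :
    MemLp (conjPlaneWave b n x) 2 := by
  have h := memLp_comp_sub_div hb x.1 (memLp_hermiteFun hb n)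
  refine h.congr_norm ?_ (Filter.Eventually.of_forall fun k => ?_)
  · exact ((by fun_prop : Continuous fun k : ℝ =>
      Complex.exp (Complex.I * k * x.2)).aestronglyMeasurable).mul h.1
  · rw [conjPlaneWave, norm_mul, Complex.norm_exp]
    simp

/-- In this form `y ↦ Pₙ(x; y)` is visibly square integrable for each `x`, and integrating it
against `f` is an inner product. -/
theorem landauKernel_eq (b : ℝ) (n : ℕ) (x y : ℝ × ℝ) :
    landauKernel b n x y = ((1 / √(2 * Real.pi) : ℝ) : ℂ) * starRingEnd ℂ
      (wignerTransform b (fun t => (hermiteFun b n t : ℂ)) (conjPlaneWave b n x) y) := by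
  have hc : (1 / (2 * Real.pi) : ℝ) = 1 / √(2 * Real.pi) * (1 / √(2 * Real.pi)) := by
    rw [div_mul_div_comm, one_mul, Real.mul_self_sqrt (by positivity)]
  rw [landauKernel, wignerTransform, map_mul, Complex.conj_ofReal, ← mul_assoc,
    ← Complex.ofReal_mul, ← hc, ← integral_conj]
  congr 2
  funext k
  rw [landauKernelIntegrand, wignerIntegrand, map_mul, map_mul, conj_conjPlaneWave,
    Complex.conj_ofReal, ← Complex.exp_conj]
  have e : Complex.exp (-Complex.I * k * (x.2 - y.2))
      = Complex.exp (starRingEnd ℂ (-Complex.I * k * y.2)) * Complex.exp (-Complex.I * k * x.2) := by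
    rw [← Complex.exp_add]
    congr 1
    simp
    ring
  rw [e]
  ring

/-- With `V` the isometry and `G` the function `conjPlaneWave b n x`, the value of `V V* f` at `x`
is `(2π)^(-1/2) ⟪G, V* f⟫ = (2π)^(-1/2) ⟪V G, f⟫`, which is the kernel integral by
`landauKernel_eq`. -/
theorem hasIntegralKernel_landauKernel {b : ℝ} (hb : b ≠ 0) (n : ℕ) :
    HasIntegralKernel (pmapEigenspace (landauOperator b) (landauLevel b n)).starProjection
      (landauKernel b n) := by
  intro f
  have hconj : ∀ x, MemLp (fun y => starRingEnd ℂ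
      (wignerTransform b (fun t => (hermiteFun b n t : ℂ)) (conjPlaneWave b n x) y)) 2 :=
    fun x => (memLp_wignerTransform hb (memLp_hermiteFun hb n) (memLp_conjPlaneWave hb n x)).star
  refine ⟨fun x => ?_, ?_⟩
  · simp only [landauKernel_eq, mul_assoc]
    exact ((hconj x).integrable_mul (Lp.memLp f)).const_mul _
  · rw [starProjection_landauEigenspace hb]
    set r := ContinuousLinearMap.adjoint (landauEmbedding hb n).toContinuousLinearMap f with hr
    refine (coeFn_landauEmbedding hb n r).trans (Filter.Eventually.of_forall fun x => ?_)
    simp only [landauKernel_eq, mul_assoc, integral_const_mul]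
    rw [wignerTransform]
    congr 1
    set G : L2Line := (memLp_conjPlaneWave hb n x).toLp _ with hG
    have h1 : ⟪landauEmbedding hb n G, f⟫_ℂ = ⟪G, r⟫_ℂ :=
      (ContinuousLinearMap.adjoint_inner_right _ _ _).symm
    rw [L2.inner_def, L2.inner_def] at h1
    refine Eq.trans ?_ (h1.symm.trans ?_)
    · refine integral_congr_ae ?_
      filter_upwards [(memLp_conjPlaneWave hb n x).coeFn_toLp] with k hk
      rw [hG, hk, RCLike.inner_apply, conj_conjPlaneWave, wignerIntegrand]
      ring
    · refine integral_congr_ae ?_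
      have h2 := coeFn_landauEmbedding hb n G
      rw [wignerTransform_congr hb (ae_eq_refl _) (memLp_conjPlaneWave hb n x).coeFn_toLp] at h2
      filter_upwards [h2] with y hy
      rw [hy, RCLike.inner_apply, mul_comm]

/-- On the diagonal the phase disappears, and the substitution `t = x₁ - k / b` turns the
normalization of `φₙ` into the Jacobian `|b|`. -/
theorem landauKernel_self {b : ℝ} (hb : b ≠ 0) (n : ℕ) (x : ℝ × ℝ) :
    landauKernel b n x x = ((|b| / (2 * Real.pi) : ℝ) : ℂ) := by
  have hc : Continuous fun t => hermiteSchwartz b hb n t * hermiteSchwartz b hb n t :=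
    (hermiteSchwartz b hb n).continuous.mul (hermiteSchwartz b hb n).continuous
  have h := integral_comp_sub_div hb x.1 hc
  rw [integral_hermiteSchwartz_mul_self] at h
  have e : ∫ k, landauKernelIntegrand b n x x k = ((|b| : ℝ) : ℂ) := by
    rw [Complex.real_smul, mul_one] at h
    rw [← h]
    congr 1
    funext k
    simp [landauKernelIntegrand, hermiteSchwartz_apply]
  rw [landauKernel, e, ← Complex.ofReal_mul]
  congr 1
  ring

/-! ### Assembly of the theorem. -/

theorem mainTheorem6 (b : ℝ) (hb : b ≠ 0) :
    -- the operator is self-adjoint, its spectrum is pure point and consists of the Landau levels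
    IsSelfAdjoint (landauOperator b) ∧
    HasPurePointSpectrum (landauOperator b) ∧
    pmapSpectrum (landauOperator b) = Set.range (fun n : ℕ => (landauLevel b n : ℂ)) ∧
    -- the transform is well defined on `L²(ℝ) × L²(ℝ)`, with values in `L²(ℝ²)`
    (∀ φ g : L2Line, (∀ x, Integrable (wignerIntegrand b φ g x)) ∧
      MemLp (wignerTransform b φ g) 2 volume) ∧
    ∀ n : ℕ,
      -- infinite multiplicity
      ¬ FiniteDimensional ℂ (pmapEigenspace (landauOperator b) (landauLevel b n)) ∧
      -- description of the eigenspace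
      MemLp (fun t => (hermiteFun b n t : ℂ)) 2 volume ∧
      (∀ f : L2Plane, f ∈ pmapEigenspace (landauOperator b) (landauLevel b n) ↔
        ∃ g : L2Line, f =ᵐ[volume] wignerTransform b (fun t => (hermiteFun b n t : ℂ)) g) ∧
      -- the kernel of the projector and its density
      (∀ x y, Integrable (landauKernelIntegrand b n x y)) ∧
      HasIntegralKernel
        (pmapEigenspace (landauOperator b) (landauLevel b n)).starProjection
        (landauKernel b n) ∧
      ∀ x, landauKernel b n x x = ((|b| / (2 * Real.pi) : ℝ) : ℂ) := by
  obtain ⟨w, β, -⟩ := exists_hilbertBasis ℂ L2Line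
  obtain ⟨e, he⟩ := exists_hilbertBasis_landauEmbedding hb β
  have hT := mem_landauOperator_graph_iff hb he
  -- A nonempty index set is needed for every level to occur among the diagonal entries indexed by
  -- `ℕ × w`.
  have hw : Nonempty w := by
    by_contra h
    rw [not_nonempty_iff] at h
    have h0 : hermiteLp hb 0 = 0 := β.ext_inner fun i => h.elim i
    have h1 := norm_hermiteLp hb 0
    rw [h0, norm_zero] at h1
    exact zero_ne_one h1
  have hrange : Set.range (fun i : ℕ × w => (landauLevel b i.1 : ℂ))
      = Set.range (fun n : ℕ => (landauLevel b n : ℂ)) :=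
    Prod.fst_surjective.range_comp (fun n : ℕ => (landauLevel b n : ℂ))
  refine ⟨isSelfAdjoint_of_diagonal e _ hT, hasPurePointSpectrum_of_diagonal e _ hT, ?_,
    fun φ g => ⟨integrable_wignerIntegrand hb (Lp.memLp φ) (Lp.memLp g),
      memLp_wignerTransform hb (Lp.memLp φ) (Lp.memLp g)⟩,
    fun n => ⟨not_finiteDimensional_landauEigenspace hb n, memLp_hermiteFun hb n,
      mem_landauEigenspace_iff_exists hb n, integrable_landauKernelIntegrand hb n,
      hasIntegralKernel_landauKernel hb n, landauKernel_self hb n⟩⟩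
  rw [← hrange]
  refine pmapSpectrum_eq_of_diagonal e _ hT fun z hz => ?_
  rw [hrange] at hz
  -- The gap `δ` is the distance from `z` to the set of levels, positive because that set is closed.
  refine ⟨_, ((isClosed_range_landauLevel hb).notMem_iff_infDist_pos
    (Set.range_nonempty _)).1 hz, fun i => ?_⟩
  rw [← dist_eq_norm, dist_comm]
  exact Metric.infDist_le_dist_of_mem ⟨i.1, rfl⟩

end
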